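/- Let $V$ be a finite-dimensional complex vector space and let $\mathcal A=\{H_1,\dots,H_n\}$, $n\ge 0$, be a central hyperplane arrangement in $V$, given by linear forms $l_1,\dots,l_n\in V^*$ with $H_i=\{x\in V : l_i(x)=0\}$ (repeated hyperplanes and zero forms are allowed). Let $M(\mathcal A)$ be the matroid on $\{1,\dots,n\}$ whose independent sets are the sets $S$ with $(l_i)_{i\in S}$ linearly independent. Write $r(S)$ for the rank of $S\subseteq\{1,\dots,n\}$ in this matroid and $r=r(\{1,\dots,n\})$ for the rank of $\mathcal A$, and let $$T_{\mathcal A}(x,y)=\sum_{S\subseteq\{1,\dots,n\}}(x-1)^{r-r(S)}(y-1)^{|S|-r(S)}$$ be its Tutte polynomial. For $h\in V$ let $\rho_{\mathcal A}(h)$ be the number of indices $i$ with $h\notin H_i$. For $k\in\{0,-1,-2\}$ let $C_{\mathcal A,k}$ be the space of polynomial functions $f\in\mathbb C[V^*]=\mathrm{Sym}(V^*)$ on $V$ such that $h(\partial)^{\rho_{\mathcal A}(h)+k+1}f=0$ for every nonzero $h\in V$, where $h(\partial)$ is the directional derivative along $h$. Let $\mathrm{Hilb}(C_{\mathcal A,k};q)=\sum_{i\ge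 0}\dim (C_{\mathcal A,k})_i\,q^i$, where $(C_{\mathcal A,k})_i$ is the subspace of homogeneous polynomials of degree $i$ in $C_{\mathcal A,k}$. Then $$\mathrm{Hilb}(C_{\mathcal A,0};q)=q^{\,n-r}\,T_{\mathcal A}\!\left(1+q,\tfrac1q\right).$$ If moreover $\mathcal A$ is essential, i.e. $H_1\cap\dots\cap H_n=\{0\}$ (equivalently $r=\dim V$), then $$\mathrm{Hilb}(C_{\mathcal A,-1};q)=q^{\,n-r}\,T_{\mathcal A}\!\left(1,\tfrac1q\right)\qquad\text{and}\qquad \mathrm{Hilb}(C_{\mathcal A,-2};q)=q^{\,n-r}\,T_{\mathcal A}\!\left(0,\tfrac1q\right).$$ All identities hold in the field $\mathbb Q((q))$ of formal Laurent series. The spaces for $k=0,-1,-2$ are the external, central and internal zonotopal spaces of $\mathcal A$, respectively. -/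

import Mathlib

open Module

noncomputable section

open scoped Classical in
/-- The matroid on `Fin n` of a finite arrangement with defining linear forms `l 0, …, l (n-1)`:
a set of indices is independent iff the corresponding linear forms are linearly independent. -/
def arrangementMatroid {V : Type*} [AddCommGroup V] [Module ℂ V] {n : ℕ}
    (l : Fin n → Dual ℂ V) : Matroid (Fin n) :=
  (IndepMatroid.ofFinite (E := Set.univ) Set.finite_univ
    (fun I => LinearIndepOn ℂ l I)
    (linearIndepOn_empty ℂ l)
    (fun _ _ hJ hIJ => hJ.mono hIJ)
    (by
      intro I J hI hJ hlt
      by_contra hcon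
      push Not at hcon
      have hsub : ∀ e ∈ J, l e ∈ Submodule.span ℂ (l '' I) := by
        intro e he
        by_cases heI : e ∈ I
        · exact Submodule.subset_span ⟨e, heI, rfl⟩
        · by_contra hns
          exact hcon e he heI (hI.insert hns)
      have hle : Submodule.span ℂ (l '' J) ≤ Submodule.span ℂ (l '' I) := by
        rw [Submodule.span_le]
        rintro _ ⟨e, he, rfl⟩
        exact hsub e he
      have key : ∀ K : Set (Fin n), LinearIndepOn ℂ l K →
          finrank ℂ (Submodule.span ℂ (l '' K)) = K.ncard := by
        intro K hK
        have h := finrank_span_eq_card (R := ℂ) (b := fun i : K => l i) hK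
        rw [Set.image_eq_range, h, Set.ncard_eq_toFinset_card', Set.toFinset_card]
      have : FiniteDimensional ℂ (Submodule.span ℂ (l '' I)) :=
        FiniteDimensional.span_of_finite ℂ ((Set.toFinite I).image l)
      have := Submodule.finrank_mono hle
      rw [key I hI, key J hJ] at this
      omega)
    (fun _ _ => Set.subset_univ _)).matroid

/-- The rank `r(A)` of a set in a matroid, as a natural number
(meaningful for matroids on a finite type, where `eRk` is finite). -/
def matroidRk {E : Type*} (M : Matroid E) (A : Set E) : ℕ := (M.eRk A).toNat

/-- The Tutte polynomial of a matroid `M` whose ground set is the finite type `E`,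
`T_M(x, y) = ∑_{A ⊆ E} (x - 1)^(r(M) - r(A)) (y - 1)^(|A| - r(A))`,
as a polynomial in the two variables `x = X 0` and `y = X 1`.
Since `r(A) ≤ r(M)` and `r(A) ≤ |A|`, the exponents are true differences. -/
def tuttePolynomial {E : Type*} [Fintype E] (M : Matroid E) : MvPolynomial (Fin 2) ℤ :=
  ∑ A : Finset E,
    (MvPolynomial.X 0 - 1) ^ (matroidRk M Set.univ - matroidRk M (A : Set E)) *
      (MvPolynomial.X 1 - 1) ^ (A.card - matroidRk M (A : Set E))

open scoped Classical in
/-- The directional degree function of the arrangement: `rhoArr l h` is the number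
of hyperplanes `{x | l i x = 0}`, counted with multiplicity, that do not contain `h`. -/
def rhoArr {V : Type*} [AddCommGroup V] [Module ℂ V] {n : ℕ}
    (l : Fin n → Dual ℂ V) (h : V) : ℕ :=
  (Finset.univ.filter fun i => l i h ≠ 0).card

/-- Polynomial functions on `V` are written as polynomials in the coordinates `y_i`
dual to a basis `b = (x_i)` of `V`. A vector `h = ∑ h_i x_i` acts on them as the directional
derivative `h(∂/∂y) = ∑ h_i ∂/∂y_i`. -/
def dirDeriv {V : Type*} [AddCommGroup V] [Module ℂ V] {ι : Type*} [Fintype ι]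
    (b : Basis ι ℂ V) (h : V) : MvPolynomial ι ℂ →ₗ[ℂ] MvPolynomial ι ℂ :=
  ∑ i, b.repr h i • (MvPolynomial.pderiv (R := ℂ) i).toLinearMap

/-- The power inverse system `C_{A,k}`: all polynomials `f` on `V` with
`h(∂/∂y)^(ρ_A(h) + k + 1) f = 0` for every nonzero `h : V`. (The exponent is nonnegative
for every nonzero `h` if `k ≥ -1`, and also if `k = -2` and the arrangement is essential.) -/
def powerInverseSystem {V : Type*} [AddCommGroup V] [Module ℂ V] {ι : Type*} [Fintype ι]
    (b : Basis ι ℂ V) {n : ℕ} (l : Fin n → Dual ℂ V) (k : ℤ) :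
    Submodule ℂ (MvPolynomial ι ℂ) :=
  ⨅ h : V, ⨅ _ : h ≠ 0, LinearMap.ker (dirDeriv b h ^ ((rhoArr l h : ℤ) + k + 1).toNat)

/-- The Hilbert series `∑_{i ≥ 0} dim(C_i) q^i` of a graded space `C` of polynomials, where `C_i`
is the space of homogeneous elements of `C` of degree `i`, as a formal power series in `q`. -/
def hilbSeries {ι : Type*} (C : Submodule ℂ (MvPolynomial ι ℂ)) : PowerSeries ℚ :=
  PowerSeries.mk fun i =>
    (finrank ℂ ↥(C ⊓ MvPolynomial.homogeneousSubmodule ι ℂ i) : ℚ)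

/-- The variable `q` in the field `ℚ((q))` of formal Laurent series. -/
def qVar : LaurentSeries ℚ := HahnSeries.single 1 1

/-- The evaluation `T_A(x, y)` of the Tutte polynomial of the matroid of the arrangement
at elements `x`, `y` of the field `ℚ((q))`. -/
def tutteEval {V : Type*} [AddCommGroup V] [Module ℂ V] {n : ℕ}
    (l : Fin n → Dual ℂ V) (x y : LaurentSeries ℚ) : LaurentSeries ℚ :=
  MvPolynomial.aeval ![x, y] (tuttePolynomial (arrangementMatroid l))

/-- The rank of the arrangement, i.e. the rank of its matroid. -/
def arrangementRank {V : Type*} [AddCommGroup V] [Module ℂ V] {n : ℕ}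
    (l : Fin n → Dual ℂ V) : ℕ :=
  matroidRk (arrangementMatroid l) Set.univ

/-- The arrangement is essential: its hyperplanes meet only in the origin. -/
def IsEssentialArr {V : Type*} [AddCommGroup V] [Module ℂ V] {n : ℕ}
    (l : Fin n → Dual ℂ V) : Prop :=
  ⨅ i, LinearMap.ker (l i) = ⊥

end

/-!
The homogeneous parts of the zonotopal spaces are treated as spaces of polynomial functions whose
degree along each direction `h` is bounded in terms of `ρ(h)`, and they are compared with sums
over subsets of the arrangement. All spaces are considered for a subspace `U` of `V` and a subset
`S` of the forms, restricted to `U`, so that deletion shrinks `S` and restriction to a hyperplane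
shrinks `U`.

*Upper bounds.* Let `a` be a form in `S` that is nonzero on `U`. A function satisfying the bounds
for `(U, S)` restricts to one satisfying the bounds for `(U ∩ ker a, S \ a)`, and if this
restriction vanishes, the function is `a` times a function for `(U, S \ a)`
(`finrank_boundedForms_le`). The evaluations of the Tutte polynomial in question, written as
`subsetWeight`, satisfy the same recursion with equality (`subsetWeight_insert`), which bounds the
dimensions from above.

*External and central spaces.* The products of the forms in `T ⊆ S` (in the central case with
complements of full rank) satisfy the bounds, and their spans satisfy the recursion as a lower
bound (`coeff_subsetWeight_le_finrank_productSpan`). Hence both inequalities are equalities, and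
the spaces are spanned by products.

*The internal space.* It need not be spanned by products of the forms. One interpolates by
semi-internal spaces: for a set `I` of forms, `h` has the central bound `deg < ρ(h)` if all forms
in `I` vanish at `h`, and the internal bound `deg < ρ(h) - 1` otherwise. The case `I = ∅` is
central, and the case of all forms is internal if the arrangement is essential. The upper bound
holds for all `I` (`finrank_semiForms_le`). For the lower bound, `e` is added to `I`. A member of
the space of `I` lies in the smaller space if and only if its top derivatives `h(∂)^(ρ(h) - 1)`
vanish for all `h` on which the forms in `I` vanish and `e` does not. For `h` not spanning an
intersection of hyperplanes this is automatic, by the spanning products of the central space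
(`dirDeriv_pow_eq_zero_of_not_line`). For each of the remaining finitely many lines, the top
derivative, restricted to `ker e`, lies in the semi-internal space of the forms vanishing on the
line (`dirDeriv_pow_semiBound_zeroSet`), whose dimension is already bounded from above. The
resulting lower bound matches an identity of weights (`subsetWeight_semiWeight_insert`).
-/

noncomputable section

/-! ### Dimension counts along a linear map -/

section Exact

variable {K M N L : Type*} [Field K] [AddCommGroup M] [Module K M] [AddCommGroup N] [Module K N]
  [AddCommGroup L] [Module K L]

lemma finrank_le_add_of_ker_le_map (A : Submodule K M) (B : Submodule K L) (C : Submodule K N)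
    (m : L →ₗ[K] M) (r : M →ₗ[K] N) (hr : ∀ f ∈ A, r f ∈ C)
    (hker : ∀ f ∈ A, r f = 0 → ∃ g ∈ B, m g = f)
    (hB : FiniteDimensional K B) (hC : FiniteDimensional K C) :
    FiniteDimensional K A ∧ finrank K A ≤ finrank K B + finrank K C := by
  have hle : A.map r ≤ C := by
    rintro _ ⟨f, hf, rfl⟩
    exact hr f hf
  have hle' : A ⊓ LinearMap.ker r ≤ B.map m := by
    rintro f ⟨hf, hf0⟩
    obtain ⟨g, hg, rfl⟩ := hker f hf hf0
    exact ⟨g, hg, rfl⟩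
  have h1 : FiniteDimensional K (A.map r) := Submodule.finiteDimensional_of_le hle
  have h2 : FiniteDimensional K (B.map m) := inferInstance
  have h3 : FiniteDimensional K ↥(A ⊓ LinearMap.ker r) := Submodule.finiteDimensional_of_le hle'
  have h4 : FiniteDimensional K A := by
    rw [← Submodule.fg_iff_finiteDimensional] at h1 h3 ⊢
    exact Submodule.fg_of_fg_map_of_fg_inf_ker r h1 h3
  refine ⟨h4, ?_⟩
  have h5 := (r.domRestrict A).finrank_range_add_finrank_ker
  have h6 : finrank K (LinearMap.range (r.domRestrict A)) ≤ finrank K C := by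
    rw [LinearMap.range_domRestrict]
    exact Submodule.finrank_mono hle
  have h7 : finrank K (LinearMap.ker (r.domRestrict A)) ≤ finrank K B := by
    have h8 : finrank K (LinearMap.ker (r.domRestrict A)) =
        finrank K ((LinearMap.ker (r.domRestrict A)).map A.subtype) :=
      (Submodule.finrank_map_subtype_eq _ _).symm
    rw [h8]
    refine (Submodule.finrank_mono (t := B.map m) ?_).trans (Submodule.finrank_map_le m B)
    rintro _ ⟨⟨f, hf⟩, hf0, rfl⟩
    exact hle' ⟨hf, hf0⟩
  omega

lemma add_finrank_le_of_map_le (A : Submodule K M) (B : Submodule K L) (C : Submodule K N)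
    (m : L →ₗ[K] M) (r : M →ₗ[K] N) (hm : ∀ g ∈ B, m g = 0 → g = 0)
    (hmA : ∀ g ∈ B, m g ∈ A) (hmr : ∀ g ∈ B, r (m g) = 0)
    (hC : C ≤ A.map r) [FiniteDimensional K A] :
    finrank K B + finrank K C ≤ finrank K A := by
  have h5 := (r.domRestrict A).finrank_range_add_finrank_ker
  have h6 : finrank K C ≤ finrank K (LinearMap.range (r.domRestrict A)) := by
    rw [LinearMap.range_domRestrict]
    exact Submodule.finrank_mono hC
  have h7 : finrank K B ≤ finrank K (LinearMap.ker (r.domRestrict A)) := by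
    let φ : B →ₗ[K] LinearMap.ker (r.domRestrict A) :=
      { toFun := fun g => ⟨⟨m g, hmA g g.2⟩, hmr g g.2⟩
        map_add' := fun x y => by ext; simp
        map_smul' := fun c x => by ext; simp }
    refine LinearMap.finrank_le_finrank_of_injective (f := φ) ?_
    refine (injective_iff_map_eq_zero φ).mpr fun x hx => ?_
    have : m x = 0 := congrArg (fun z : LinearMap.ker (r.domRestrict A) => ((z : A) : M)) hx
    exact Subtype.ext (hm x x.2 this)
  omega

end Exact

/-! ### Polynomial functions with bounded directional degrees -/

section PolyFun

variable {W W' : Type*} [AddCommGroup W] [Module ℂ W] [AddCommGroup W'] [Module ℂ W']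

/-- The algebra of polynomial functions on a complex vector space, generated by the linear
forms inside all functions. -/
def polyFun (W : Type*) [AddCommGroup W] [Module ℂ W] : Subalgebra ℂ (W → ℂ) :=
  Algebra.adjoin ℂ (Set.range fun φ : Dual ℂ W => (φ : W → ℂ))

lemma coe_dual_mem_polyFun (φ : Dual ℂ W) : (φ : W → ℂ) ∈ polyFun W :=
  Algebra.subset_adjoin ⟨φ, rfl⟩

@[elab_as_elim]
lemma polyFun_induction {p : (f : W → ℂ) → f ∈ polyFun W → Prop}
    (hφ : ∀ φ : Dual ℂ W, p φ (coe_dual_mem_polyFun φ))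
    (hc : ∀ c : ℂ, p (fun _ => c) ((polyFun W).algebraMap_mem c))
    (hadd : ∀ f g hf hg, p f hf → p g hg → p (f + g) (add_mem hf hg))
    (hmul : ∀ f g hf hg, p f hf → p g hg → p (f * g) (mul_mem hf hg))
    {f : W → ℂ} (hf : f ∈ polyFun W) : p f hf := by
  refine Algebra.adjoin_induction (p := fun f hf => p f hf) ?_ ?_ ?_ ?_ hf
  · rintro _ ⟨φ, rfl⟩
    exact hφ φ
  · intro c
    exact hc c
  · intro f g hf hg
    exact hadd f g hf hg
  · intro f g hf hg
    exact hmul f g hf hg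

lemma comp_mem_polyFun (j : W' →ₗ[ℂ] W) {f : W → ℂ} (hf : f ∈ polyFun W) :
    (fun x => f (j x)) ∈ polyFun W' := by
  induction hf using polyFun_induction with
  | hφ φ => exact coe_dual_mem_polyFun (φ.comp j)
  | hc c => exact (polyFun W').algebraMap_mem c
  | hadd f g hf hg h1 h2 => exact (polyFun W').add_mem h1 h2
  | hmul f g hf hg h1 h2 => exact (polyFun W').mul_mem h1 h2

/-- Evaluation of polynomial functions at a point. -/
def evalPolyFun (x : W) : polyFun W →+* ℂ :=
  (Pi.evalRingHom (fun _ : W => ℂ) x).comp (polyFun W).val.toRingHom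

@[simp] lemma evalPolyFun_apply (x : W) (f : polyFun W) : evalPolyFun x f = (f : W → ℂ) x := rfl

/-- The Taylor expansion of a polynomial function along a direction `h`: the coefficients of
`t ↦ f (x + t • h)` are polynomial functions of the base point `x`. -/
lemma exists_expansion (h : W) {f : W → ℂ} (hf : f ∈ polyFun W) :
    ∃ P : Polynomial (polyFun W), ∀ x t, f (x + t • h) = (P.map (evalPolyFun x)).eval t := by
  induction hf using polyFun_induction with
  | hφ φ =>
    refine ⟨Polynomial.C ⟨φ, coe_dual_mem_polyFun φ⟩ +
      Polynomial.C (algebraMap ℂ _ (φ h)) * Polynomial.X, fun x t => ?_⟩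
    simp [mul_comm t]
  | hc c => exact ⟨Polynomial.C (algebraMap ℂ _ c), fun x t => by simp⟩
  | hadd f g hf hg h1 h2 =>
    obtain ⟨P, hP⟩ := h1
    obtain ⟨Q, hQ⟩ := h2
    exact ⟨P + Q, fun x t => by simp [hP, hQ]⟩
  | hmul f g hf hg h1 h2 =>
    obtain ⟨P, hP⟩ := h1
    obtain ⟨Q, hQ⟩ := h2
    exact ⟨P * Q, fun x t => by simp [hP, hQ]⟩

lemma exists_line_polynomial (x h : W) {f : W → ℂ} (hf : f ∈ polyFun W) :
    ∃ p : Polynomial ℂ, ∀ t, f (x + t • h) = p.eval t :=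
  let ⟨P, hP⟩ := exists_expansion h hf
  ⟨P.map (evalPolyFun x), hP x⟩

/-- A polynomial function annihilated by a nonzero linear form vanishes. -/
lemma eq_zero_of_dual_mul_eq_zero {a : Dual ℂ W} (ha : a ≠ 0) {g : W → ℂ} (hg : g ∈ polyFun W)
    (h : ∀ x, a x * g x = 0) : g = 0 := by
  obtain ⟨v, hv⟩ : ∃ v, a v ≠ 0 := by
    by_contra hcon
    push Not at hcon
    exact ha (LinearMap.ext hcon)
  funext x
  obtain ⟨p, hp⟩ := exists_line_polynomial x v hg
  have h1 : (Polynomial.C (a x) + Polynomial.C (a v) * Polynomial.X) * p = 0 := by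
    refine Polynomial.funext fun t => ?_
    have := h (x + t • v)
    rw [hp] at this
    simpa [mul_comm t] using this
  have h2 : (Polynomial.C (a x) + Polynomial.C (a v) * Polynomial.X) ≠ 0 := by
    intro h0
    have := congrArg (fun q => Polynomial.coeff q 1) h0
    simp [Polynomial.coeff_C] at this
    exact hv this
  have h3 : p = 0 := (mul_eq_zero.mp h1).resolve_left h2
  simpa [h3] using hp 0

/-- Polynomial functions on `W` that are homogeneous of degree `i` and whose restriction to every
line with direction `h ≠ 0` has degree less than `μ h`. The degree `i` is an integer, so that the
index may be shifted freely; homogeneity is only required for nonzero scalars. -/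
def boundedForms (W : Type*) [AddCommGroup W] [Module ℂ W] (μ : W → ℕ) (i : ℤ) :
    Submodule ℂ (W → ℂ) where
  carrier := {f | f ∈ polyFun W ∧
    (∀ h ≠ 0, ∀ x, ∃ p ∈ Polynomial.degreeLT ℂ (μ h), ∀ t, f (x + t • h) = p.eval t) ∧
    ∀ c : ℂ, c ≠ 0 → ∀ x, f (c • x) = c ^ i * f x}
  zero_mem' := ⟨zero_mem _, fun _ _ _ => ⟨0, zero_mem _, fun _ => by simp⟩, fun _ _ _ => by simp⟩
  add_mem' := by
    rintro f g ⟨hf1, hf2, hf3⟩ ⟨hg1, hg2, hg3⟩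
    refine ⟨add_mem hf1 hg1, fun h hh x => ?_, fun c hc x => ?_⟩
    · obtain ⟨p, hp, hp'⟩ := hf2 h hh x
      obtain ⟨q, hq, hq'⟩ := hg2 h hh x
      exact ⟨p + q, add_mem hp hq, fun t => by simp [hp', hq']⟩
    · simp [hf3 c hc, hg3 c hc, mul_add]
  smul_mem' := by
    rintro a f ⟨hf1, hf2, hf3⟩
    refine ⟨Subalgebra.smul_mem _ hf1 a, fun h hh x => ?_, fun c hc x => ?_⟩
    · obtain ⟨p, hp, hp'⟩ := hf2 h hh x
      exact ⟨a • p, Submodule.smul_mem _ _ hp, fun t => by simp [hp']⟩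
    · simp [hf3 c hc, mul_left_comm]

lemma eq_zero_of_mem_boundedForms {μ : W → ℕ} {i : ℤ} {f : W → ℂ} (hf : f ∈ boundedForms W μ i)
    {h : W} (hh : h ≠ 0) (h0 : μ h = 0) : f = 0 := by
  funext x
  obtain ⟨p, hp, hp'⟩ := hf.2.1 h hh x
  rw [h0, Polynomial.mem_degreeLT, Polynomial.degree_lt_iff_coeff_zero] at hp
  have : p = 0 := Polynomial.ext fun m => by simpa using hp m (Nat.zero_le _)
  simpa [this] using hp' 0

lemma restrict_mem_boundedForms (j : W' →ₗ[ℂ] W) (hj : Function.Injective j) {μ : W → ℕ}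
    {i : ℤ} {f : W → ℂ} (hf : f ∈ boundedForms W μ i) :
    (fun x => f (j x)) ∈ boundedForms W' (fun x => μ (j x)) i := by
  refine ⟨comp_mem_polyFun j hf.1, fun h hh x => ?_, fun c hc x => ?_⟩
  · obtain ⟨p, hp, hp'⟩ := hf.2.1 (j h) (by rwa [Ne, map_eq_zero_iff j hj]) (j x)
    exact ⟨p, hp, fun t => by simp [hp']⟩
  · simp [hf.2.2 c hc]

/-- A polynomial function is, modulo a linear form `a` with `a v = 1`, the pullback of its
restriction to `ker a` along the projection with direction `v`. -/
lemma exists_quotient {a : Dual ℂ W} {v : W} {f : W → ℂ} (hf : f ∈ polyFun W) :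
    ∃ g ∈ polyFun W, ∀ x, f x = f (x - a x • v) + a x * g x := by
  have hproj : ∀ f ∈ polyFun W, (fun x => f (x - a x • v)) ∈ polyFun W := fun f hf =>
    comp_mem_polyFun (LinearMap.id - a.smulRight v) hf
  induction hf using polyFun_induction with
  | hφ φ => exact ⟨fun _ => φ v, (polyFun W).algebraMap_mem (φ v), fun x => by simp⟩
  | hc c => exact ⟨0, zero_mem _, fun x => by simp⟩
  | hadd f g hf hg h1 h2 =>
    obtain ⟨p, hp, hp'⟩ := h1
    obtain ⟨q, hq, hq'⟩ := h2
    refine ⟨p + q, add_mem hp hq, fun x => ?_⟩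
    simp only [Pi.add_apply]
    rw [hp' x, hq' x]
    ring
  | hmul f g hf hg h1 h2 =>
    obtain ⟨p, hp, hp'⟩ := h1
    obtain ⟨q, hq, hq'⟩ := h2
    refine ⟨p * g + (fun x => f (x - a x • v)) * q, add_mem (mul_mem hp hg)
      (mul_mem (hproj f hf) hq), fun x => ?_⟩
    simp only [Pi.add_apply, Pi.mul_apply]
    linear_combination (f (x - a x • v)) * hq' x + g x * hp' x

/-- A function in `boundedForms W μ i` that vanishes on the hyperplane `ker a` is divisible by `a`,
and the quotient satisfies the bounds that are smaller by one in all directions leaving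
`ker a`. -/
lemma exists_mem_boundedForms_of_vanish {a : Dual ℂ W} (ha : a ≠ 0) {μ μ' : W → ℕ}
    (h1 : ∀ h, h ≠ 0 → a h ≠ 0 → μ h ≤ μ' h + 1) (h2 : ∀ h, h ≠ 0 → a h = 0 → μ h ≤ μ' h)
    {i : ℤ} {f : W → ℂ} (hf : f ∈ boundedForms W μ i) (hf0 : ∀ x, a x = 0 → f x = 0) :
    ∃ g ∈ boundedForms W μ' (i - 1), ∀ x, f x = a x * g x := by
  obtain ⟨v', hv'⟩ : ∃ v, a v ≠ 0 := by
    by_contra hcon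
    push Not at hcon
    exact ha (LinearMap.ext hcon)
  obtain ⟨v, hv⟩ : ∃ v, a v = 1 := ⟨(a v')⁻¹ • v', by simp [hv']⟩
  obtain ⟨g, hg, hfg⟩ := exists_quotient (a := a) (v := v) hf.1
  have hfg' : ∀ x, f x = a x * g x := fun x => by
    rw [hfg x, hf0 _ (by simp [hv]), zero_add]
  refine ⟨g, ⟨hg, fun h hh x => ?_, fun c hc x => ?_⟩, hfg'⟩
  · by_cases hah : a h = 0
    · -- the Taylor coefficients of `f` along `h` are those of `g` multiplied by `a`
      obtain ⟨P, hP⟩ := exists_expansion h hg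
      refine ⟨P.map (evalPolyFun x), ?_, hP x⟩
      rw [Polynomial.mem_degreeLT, Polynomial.degree_lt_iff_coeff_zero]
      intro m hm
      have hm0 : (P.coeff m : W → ℂ) = 0 := by
        refine eq_zero_of_dual_mul_eq_zero ha (P.coeff m).2 fun y => ?_
        obtain ⟨p, hp, hp'⟩ := hf.2.1 h hh y
        have hpe : p = Polynomial.C (a y) * P.map (evalPolyFun y) := by
          refine Polynomial.funext fun t => ?_
          rw [← hp' t, hfg', hP]
          simp [hah]
        rw [Polynomial.mem_degreeLT, Polynomial.degree_lt_iff_coeff_zero] at hp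
        have := hp m ((h2 h hh hah).trans hm)
        rw [hpe] at this
        simpa using this
      simp [hm0]
    · -- along `h` the form `a` is a nonconstant linear polynomial, so division lowers the degree
      obtain ⟨q, hq⟩ := exists_line_polynomial x h hg
      obtain ⟨p, hp, hp'⟩ := hf.2.1 h hh x
      refine ⟨q, ?_, hq⟩
      have hpe : p = (Polynomial.C (a h) * Polynomial.X + Polynomial.C (a x)) * q := by
        refine Polynomial.funext fun t => ?_
        rw [← hp' t, hfg', hq]
        simp only [map_add, map_smul, smul_eq_mul, Polynomial.eval_mul, Polynomial.eval_add,
          Polynomial.eval_C, Polynomial.eval_X]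
        ring
      rw [Polynomial.mem_degreeLT] at hp ⊢
      rcases eq_or_ne q 0 with rfl | hq0
      · simp
      rw [hpe, Polynomial.degree_mul, Polynomial.degree_linear hah,
        Polynomial.degree_eq_natDegree hq0] at hp
      rw [Polynomial.degree_eq_natDegree hq0]
      have h3 := h1 h hh hah
      norm_cast at hp ⊢
      omega
  · -- the defect of homogeneity of `g` is a polynomial function annihilated by `a`
    have hgc : (fun x => g (c • x)) - c ^ (i - 1) • g ∈ polyFun W :=
      sub_mem (comp_mem_polyFun (c • LinearMap.id) hg) (Subalgebra.smul_mem _ hg _)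
    have h0 := eq_zero_of_dual_mul_eq_zero ha hgc fun y => by
      have h3 := hf.2.2 c hc y
      rw [hfg', hfg'] at h3
      have h4 : c * (a y * (g (c • y) - c ^ (i - 1) * g y)) = 0 := by
        have h5 : c ^ i = c * c ^ (i - 1) := by
          rw [← zpow_one_add₀ hc]
          congr 1
          ring
        rw [h5] at h3
        simp only [map_smul, smul_eq_mul] at h3
        linear_combination h3
      simpa [hc] using h4
    have h6 := congrFun h0 x
    simp only [Pi.sub_apply, Pi.smul_apply, smul_eq_mul, Pi.zero_apply] at h6
    exact sub_eq_zero.mp h6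

/-- Multiplication by a linear form. -/
def mulDual (a : Dual ℂ W) : (W → ℂ) →ₗ[ℂ] (W → ℂ) where
  toFun f := fun x => a x * f x
  map_add' f g := by
    funext x
    simp [mul_add]
  map_smul' c f := by
    funext x
    simp [mul_left_comm]

/-- Restriction of functions along a linear map. -/
def restrictFun (j : W' →ₗ[ℂ] W) : (W → ℂ) →ₗ[ℂ] (W' → ℂ) where
  toFun f := fun x => f (j x)
  map_add' _ _ := rfl
  map_smul' _ _ := rfl

/-- Left exactness of deletion and restriction: restricting to the hyperplane `ker a` has a kernel
consisting of multiples of `a`. -/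
lemma finrank_boundedForms_le {a : Dual ℂ W} (ha : a ≠ 0) (j : W' →ₗ[ℂ] W)
    (hj : Function.Injective j) (hja : ∀ x, a x = 0 → ∃ y, j y = x) {μ μ' : W → ℕ}
    (h1 : ∀ h, h ≠ 0 → a h ≠ 0 → μ h ≤ μ' h + 1) (h2 : ∀ h, h ≠ 0 → a h = 0 → μ h ≤ μ' h) (i : ℤ)
    (hB : FiniteDimensional ℂ (boundedForms W μ' (i - 1)))
    (hC : FiniteDimensional ℂ (boundedForms W' (fun x => μ (j x)) i)) :
    FiniteDimensional ℂ (boundedForms W μ i) ∧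
      finrank ℂ (boundedForms W μ i) ≤ finrank ℂ (boundedForms W μ' (i - 1)) +
        finrank ℂ (boundedForms W' (fun x => μ (j x)) i) := by
  refine finrank_le_add_of_ker_le_map _ _ _ (mulDual a) (restrictFun j)
    (fun f hf => restrict_mem_boundedForms j hj hf) (fun f hf hf0 => ?_) hB hC
  obtain ⟨g, hg, hfg⟩ := exists_mem_boundedForms_of_vanish ha h1 h2 hf fun x hx => by
    obtain ⟨y, rfl⟩ := hja x hx
    exact congrFun hf0 y
  exact ⟨g, hg, funext fun x => (hfg x).symm⟩

lemma boundedForms_le_span_one {μ : W → ℕ} (hμ : ∀ h, h ≠ 0 → μ h ≤ 1) (i : ℤ) :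
    boundedForms W μ i ≤ if i = 0 then Submodule.span ℂ {fun _ => 1} else ⊥ := by
  intro f hf
  have hconst : ∀ x, f x = f 0 := fun x => by
    rcases eq_or_ne x 0 with rfl | hx
    · rfl
    obtain ⟨p, hp, hp'⟩ := hf.2.1 x hx 0
    have hp1 : p.degree < 1 := by
      rw [Polynomial.mem_degreeLT] at hp
      exact hp.trans_le (by exact_mod_cast hμ x hx)
    have hpc : p = Polynomial.C (p.coeff 0) := Polynomial.eq_C_of_degree_le_zero
      (Polynomial.degree_le_iff_coeff_zero _ _ |>.mpr fun m hm =>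
        Polynomial.coeff_eq_zero_of_degree_lt (hp1.trans_le (by
          have : 1 ≤ m := by exact_mod_cast hm
          exact_mod_cast this)))
    have e1 := hp' 1
    have e0 := hp' 0
    rw [hpc] at e1 e0
    simp at e1 e0
    rw [e1, e0]
  split_ifs with hi
  · refine Submodule.mem_span_singleton.mpr ⟨f 0, ?_⟩
    funext x
    simp [hconst x]
  · have h2 := hf.2.2 2 two_ne_zero 0
    rw [smul_zero] at h2
    have hne : (2 : ℂ) ^ i ≠ 1 := by
      intro h3
      have h4 : ((2 : ℝ) ^ i) = 1 := by simpa using congrArg norm h3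
      exact hi ((zpow_eq_one_iff_right₀ (by norm_num) (by norm_num)).mp h4)
    have h5 : f 0 = 0 := by
      have h6 : ((2 : ℂ) ^ i - 1) * f 0 = 0 := by linear_combination -h2
      exact (mul_eq_zero.mp h6).resolve_left (sub_ne_zero.mpr hne)
    refine (Submodule.mem_bot ℂ).mpr (funext fun x => ?_)
    simp [hconst x, h5]

end PolyFun

/-! ### Weighted sums over the subsets of an arrangement -/

section Weight

variable {V : Type*} [AddCommGroup V] [Module ℂ V] {n : ℕ} (l : Fin n → Dual ℂ V)

/-- The intersection of the hyperplanes with indices in `T`. -/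
def flatOf (T : Finset (Fin n)) : Submodule ℂ V := ⨅ i ∈ T, LinearMap.ker (l i)

variable {l}

lemma mem_flatOf {T : Finset (Fin n)} {x : V} : x ∈ flatOf l T ↔ ∀ i ∈ T, l i x = 0 := by
  simp [flatOf, Submodule.mem_iInf]

variable (l)

@[simp] lemma flatOf_empty : flatOf l ∅ = ⊤ := by simp [flatOf]

lemma flatOf_insert (a : Fin n) (T : Finset (Fin n)) :
    flatOf l (insert a T) = LinearMap.ker (l a) ⊓ flatOf l T := by
  ext x
  simp [mem_flatOf]

lemma flatOf_anti {S T : Finset (Fin n)} (h : S ⊆ T) : flatOf l T ≤ flatOf l S := fun _ hx =>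
  mem_flatOf.mpr fun i hi => mem_flatOf.mp hx i (h hi)

/-- The sum over the subsets `T` of `S`, with weight
`φ (U ∩ T^⊥) q ^ (|S| - |T|) (1 - q) ^ (|T| - r_U(T))`, where `r_U(T)` is the rank of the
restrictions to `U` of the forms with indices in `T`, that is the codimension of `U ∩ T^⊥`
in `U`. -/
def subsetWeight (φ : Submodule ℂ V → LaurentSeries ℚ) (U : Submodule ℂ V)
    (S : Finset (Fin n)) : LaurentSeries ℚ :=
  ∑ T ∈ S.powerset, φ (U ⊓ flatOf l T) * qVar ^ ((S.card : ℤ) - T.card) *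
    (1 - qVar) ^ ((T.card : ℤ) + finrank ℂ ↥(U ⊓ flatOf l T) - finrank ℂ U)

lemma qVar_ne_zero : qVar ≠ 0 := by
  simp [qVar]

lemma one_sub_qVar_ne_zero : (1 - qVar : LaurentSeries ℚ) ≠ 0 := by
  intro h
  have := congrArg (fun x => HahnSeries.coeff x (1 : ℤ)) h
  simp [qVar] at this

lemma coeff_qVar_mul (x : LaurentSeries ℚ) (i : ℤ) : (qVar * x).coeff i = x.coeff (i - 1) := by
  have := HahnSeries.coeff_single_mul_add (r := (1 : ℚ)) (x := x) (a := i - 1) (b := (1 : ℤ))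
  simpa [qVar] using this

lemma coeff_qVar_pow_mul (m : ℕ) (x : LaurentSeries ℚ) (i : ℤ) :
    (qVar ^ m * x).coeff i = x.coeff (i - m) := by
  induction m generalizing i with
  | zero => simp
  | succ m ih =>
    rw [pow_succ', mul_assoc, coeff_qVar_mul, ih]
    congr 1
    push_cast
    ring

variable (φ : Submodule ℂ V → LaurentSeries ℚ) (U : Submodule ℂ V)

@[simp] lemma subsetWeight_empty : subsetWeight l φ U ∅ = φ U := by
  have h : U ⊓ flatOf l ∅ = U := by simp
  rw [subsetWeight, Finset.powerset_empty, Finset.sum_singleton, h]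
  simp

lemma inf_flatOf_insert_of_le {a : Fin n} (ha : U ≤ LinearMap.ker (l a)) (T : Finset (Fin n)) :
    U ⊓ flatOf l (insert a T) = U ⊓ flatOf l T := by
  rw [flatOf_insert, ← inf_assoc, inf_eq_left.mpr ha]

lemma subsetWeight_insert_of_le {a : Fin n} {S : Finset (Fin n)} (haS : a ∉ S)
    (ha : U ≤ LinearMap.ker (l a)) : subsetWeight l φ U (insert a S) = subsetWeight l φ U S := by
  unfold subsetWeight
  rw [Finset.sum_powerset_insert haS, ← Finset.sum_add_distrib]
  refine Finset.sum_congr rfl fun T hT => ?_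
  have haT : a ∉ T := fun h => haS (Finset.mem_powerset.mp hT h)
  rw [inf_flatOf_insert_of_le l U ha, Finset.card_insert_of_notMem haS,
    Finset.card_insert_of_notMem haT]
  push_cast
  have e1 : (S.card : ℤ) + 1 - T.card = (S.card - T.card) + 1 := by ring
  have e2 : (S.card : ℤ) + 1 - (T.card + 1) = S.card - T.card := by ring
  have e3 : (T.card : ℤ) + 1 + finrank ℂ ↥(U ⊓ flatOf l T) - finrank ℂ U =
    (T.card + finrank ℂ ↥(U ⊓ flatOf l T) - finrank ℂ U) + 1 := by ring
  rw [e1, e2, e3, zpow_add_one₀ qVar_ne_zero, zpow_add_one₀ one_sub_qVar_ne_zero]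
  ring

lemma finrank_inf_ker_add_one [FiniteDimensional ℂ V] {a : Dual ℂ V}
    (ha : ¬ U ≤ LinearMap.ker a) : finrank ℂ ↥(U ⊓ LinearMap.ker a) + 1 = finrank ℂ U := by
  have hne : a.domRestrict U ≠ 0 := by
    intro h
    refine ha fun x hx => ?_
    exact LinearMap.congr_fun h ⟨x, hx⟩
  have h1 := Module.Dual.finrank_ker_add_one_of_ne_zero hne
  have h2 : (LinearMap.ker (a.domRestrict U)).map U.subtype = U ⊓ LinearMap.ker a := by
    ext x
    simp only [Submodule.mem_map, LinearMap.mem_ker, LinearMap.domRestrict_apply,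
      Submodule.subtype_apply, Subtype.exists, exists_and_left, exists_prop, exists_eq_right_right,
      Submodule.mem_inf]
    tauto
  rw [← h2, Submodule.finrank_map_subtype_eq]
  exact h1

lemma subsetWeight_insert [FiniteDimensional ℂ V] {a : Fin n} {S : Finset (Fin n)} (haS : a ∉ S)
    (ha : ¬ U ≤ LinearMap.ker (l a)) :
    subsetWeight l φ U (insert a S) = qVar * subsetWeight l φ U S +
      subsetWeight l φ (U ⊓ LinearMap.ker (l a)) S := by
  have hU := finrank_inf_ker_add_one U ha
  unfold subsetWeight
  rw [Finset.sum_powerset_insert haS, Finset.mul_sum]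
  congr 1
  · refine Finset.sum_congr rfl fun T hT => ?_
    rw [Finset.card_insert_of_notMem haS]
    push_cast
    have e1 : (S.card : ℤ) + 1 - T.card = (S.card - T.card) + 1 := by ring
    rw [e1, zpow_add_one₀ qVar_ne_zero]
    ring
  · refine Finset.sum_congr rfl fun T hT => ?_
    have haT : a ∉ T := fun h => haS (Finset.mem_powerset.mp hT h)
    rw [Finset.card_insert_of_notMem haS, Finset.card_insert_of_notMem haT, flatOf_insert,
      ← inf_assoc, ← hU]
    push_cast
    have e2 : (S.card : ℤ) + 1 - (T.card + 1) = S.card - T.card := by ring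
    have e3 (m k : ℤ) : (T.card : ℤ) + 1 + m - (k + 1) = T.card + m - k := by ring
    rw [e2, e3]

end Weight

/-! ### Products of the linear forms -/

section Products

variable {V : Type*} [AddCommGroup V] [Module ℂ V] {n : ℕ} (l : Fin n → Dual ℂ V)

/-- The product of the linear forms with indices in `T`, as a function on `U`. -/
def prodForm (U : Submodule ℂ V) (T : Finset (Fin n)) : U → ℂ := fun x => ∏ i ∈ T, l i x

/-- The span of the products of `i` of the forms with indices in `S` whose complement in `S` cuts
out from `U` a subspace with the property `π`. -/
def productSpan (π : Submodule ℂ V → Prop) (U : Submodule ℂ V) (S : Finset (Fin n)) (i : ℤ) :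
    Submodule ℂ (U → ℂ) :=
  Submodule.span ℂ (prodForm l U '' {T | T ⊆ S ∧ (T.card : ℤ) = i ∧ π (U ⊓ flatOf l (S \ T))})

instance (π : Submodule ℂ V → Prop) (U : Submodule ℂ V) (S : Finset (Fin n)) (i : ℤ) :
    FiniteDimensional ℂ (productSpan l π U S i) :=
  FiniteDimensional.span_of_finite ℂ ((Set.toFinite _).image _)

variable {l}

lemma prodForm_mem_polyFun (U : Submodule ℂ V) (T : Finset (Fin n)) :
    prodForm l U T ∈ polyFun U := by
  have h : prodForm l U T = ∏ i ∈ T, ((l i).domRestrict U : U → ℂ) := by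
    funext x
    simp [prodForm]
  rw [h]
  exact prod_mem fun i _ => coe_dual_mem_polyFun ((l i).domRestrict U)

lemma prodForm_mem_productSpan {π : Submodule ℂ V → Prop} {U : Submodule ℂ V}
    {S T : Finset (Fin n)} {i : ℤ} (hT : T ⊆ S) (hi : (T.card : ℤ) = i)
    (hπ : π (U ⊓ flatOf l (S \ T))) : prodForm l U T ∈ productSpan l π U S i :=
  Submodule.subset_span ⟨T, ⟨hT, hi, hπ⟩, rfl⟩

lemma mem_polyFun_of_mem_productSpan {π : Submodule ℂ V → Prop} {U : Submodule ℂ V}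
    {S : Finset (Fin n)} {i : ℤ} {f : U → ℂ} (hf : f ∈ productSpan l π U S i) : f ∈ polyFun U := by
  have h : productSpan l π U S i ≤ Subalgebra.toSubmodule (polyFun U) := by
    refine Submodule.span_le.mpr ?_
    rintro _ ⟨T, -, rfl⟩
    exact prodForm_mem_polyFun U T
  exact h hf

lemma productSpan_of_neg (π : Submodule ℂ V → Prop) (U : Submodule ℂ V) (S : Finset (Fin n))
    {i : ℤ} (hi : i < 0) : productSpan l π U S i = ⊥ := by
  have h : {T | T ⊆ S ∧ (T.card : ℤ) = i ∧ π (U ⊓ flatOf l (S \ T))} = ∅ := by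
    ext T
    simp only [Set.mem_ofPred_eq, Set.mem_empty_iff_false, iff_false]
    rintro ⟨-, h, -⟩
    omega
  rw [productSpan, h, Set.image_empty, Submodule.span_empty]

variable (l)

lemma domRestrict_ne_zero {U : Submodule ℂ V} {a : Dual ℂ V} (ha : ¬ U ≤ LinearMap.ker a) :
    a.domRestrict U ≠ 0 := fun h => ha fun x hx => LinearMap.congr_fun h ⟨x, hx⟩

open scoped Classical in
/-- The products span a space at least as large as the weighted count predicts: multiplication by a
form and restriction to its hyperplane match the recursion of `subsetWeight`. -/
lemma coeff_subsetWeight_le_finrank_productSpan [FiniteDimensional ℂ V]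
    (π : Submodule ℂ V → Prop) (S : Finset (Fin n)) (U : Submodule ℂ V) (i : ℤ) :
    (subsetWeight l (fun D => if π D then 1 else 0) U S).coeff i ≤
      (finrank ℂ (productSpan l π U S i) : ℚ) := by
  induction S using Finset.induction_on generalizing U i with
  | empty =>
    rw [subsetWeight_empty]
    by_cases hπ : π U
    · rw [if_pos hπ, HahnSeries.coeff_one]
      split_ifs with hi
      · have h1 : prodForm l U ∅ ∈ productSpan l π U ∅ i :=
          prodForm_mem_productSpan (Finset.Subset.refl _) (by simp [hi]) (by simpa using hπ)
        have h2 : (⟨_, h1⟩ : productSpan l π U ∅ i) ≠ 0 := by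
          intro h
          have := congrFun (congrArg Subtype.val h) 0
          simp [prodForm] at this
        have : Nontrivial (productSpan l π U ∅ i) := ⟨_, _, h2⟩
        exact_mod_cast Nat.one_le_iff_ne_zero.mpr (finrank_pos).ne'
      · positivity
    · rw [if_neg hπ, HahnSeries.coeff_zero]
      positivity
  | insert a S haS ih =>
    by_cases ha : U ≤ LinearMap.ker (l a)
    · rw [subsetWeight_insert_of_le l _ U haS ha]
      refine (ih U i).trans ?_
      norm_cast
      refine Submodule.finrank_mono (Submodule.span_mono (Set.image_mono ?_))
      rintro T ⟨hT, hi, hπ⟩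
      have haT : a ∉ T := fun h => haS (hT h)
      refine ⟨hT.trans (Finset.subset_insert _ _), hi, ?_⟩
      rwa [Finset.insert_sdiff_of_notMem _ haT, inf_flatOf_insert_of_le l U ha]
    · rw [subsetWeight_insert l _ U haS ha, HahnSeries.coeff_add, coeff_qVar_mul]
      refine (add_le_add (ih U (i - 1)) (ih _ i)).trans ?_
      norm_cast
      refine add_finrank_le_of_map_le _ _ _ (mulDual ((l a).domRestrict U))
        (restrictFun (Submodule.inclusion inf_le_left)) ?_ ?_ ?_ ?_
      · intro g hg h0
        exact eq_zero_of_dual_mul_eq_zero (domRestrict_ne_zero ha)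
          (mem_polyFun_of_mem_productSpan hg) fun x => congrFun h0 x
      · intro g hg
        refine Submodule.span_induction (p := fun g _ => mulDual _ g ∈ _) ?_ (by simp)
          (fun x y _ _ hx hy => by rw [map_add]; exact add_mem hx hy)
          (fun c x _ hx => by rw [map_smul]; exact Submodule.smul_mem _ _ hx) hg
        rintro _ ⟨T, ⟨hT, hi, hπ⟩, rfl⟩
        have haT : a ∉ T := fun h => haS (hT h)
        have h1 : mulDual ((l a).domRestrict U) (prodForm l U T) = prodForm l U (insert a T) := by
          funext x
          simp [mulDual, prodForm, Finset.prod_insert haT]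
        rw [h1]
        refine prodForm_mem_productSpan (Finset.insert_subset_insert a hT) ?_ ?_
        · rw [Finset.card_insert_of_notMem haT]
          push_cast
          omega
        · rwa [Finset.insert_sdiff_insert, Finset.sdiff_insert_of_notMem haS]
      · intro g hg
        funext x
        have : l a x = 0 := x.2.2
        simp [mulDual, restrictFun, this]
      · refine Submodule.span_le.mpr ?_
        rintro _ ⟨T, ⟨hT, hi, hπ⟩, rfl⟩
        have haT : a ∉ T := fun h => haS (hT h)
        refine ⟨prodForm l U T,
          prodForm_mem_productSpan (hT.trans (Finset.subset_insert _ _)) hi ?_, rfl⟩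
        rwa [Finset.insert_sdiff_of_notMem _ haT, flatOf_insert, ← inf_assoc]

end Products

/-! ### Degree bounds given by an arrangement -/

section Bounds

variable {V : Type*} [AddCommGroup V] [Module ℂ V] {n : ℕ} (l : Fin n → Dual ℂ V)

open scoped Classical in
/-- The number of forms with indices in `S` that do not vanish at `h`. -/
def rhoOn (S : Finset (Fin n)) (h : V) : ℕ := (S.filter fun i => l i h ≠ 0).card

open scoped Classical in
/-- The semi-internal degree bound: directions on which all forms with indices in `I` vanish are
treated as in the central case (bound `ρ`), the others as in the internal case (bound `ρ - 1`).
The subtraction is truncated: a bound of zero already forces a function to vanish. -/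
def semiBound (S I : Finset (Fin n)) (h : V) : ℕ :=
  rhoOn l S h - if h ∈ flatOf l I then 0 else 1

open scoped Classical in
/-- The weight whose sum over subsets counts the semi-internal space. For `I = ∅` it is the
indicator of the zero subspace; if the forms with indices in `I` have no common zero, it is the
full weight of the internal case. -/
def semiWeight (I : Finset (Fin n)) (D : Submodule ℂ V) : LaurentSeries ℚ :=
  if D ⊓ flatOf l I = ⊥ then (-qVar⁻¹) ^ finrank ℂ D else 0

variable {l}

lemma rhoOn_insert_of_ne {a : Fin n} {S : Finset (Fin n)} (haS : a ∉ S) {h : V} (ha : l a h ≠ 0) :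
    rhoOn l (insert a S) h = rhoOn l S h + 1 := by
  classical
  rw [rhoOn, Finset.filter_insert, if_pos ha, Finset.card_insert_of_notMem (by simp [haS]), rhoOn]

lemma rhoOn_insert_of_eq {a : Fin n} {S : Finset (Fin n)} {h : V} (ha : l a h = 0) :
    rhoOn l (insert a S) h = rhoOn l S h := by
  classical
  rw [rhoOn, Finset.filter_insert, if_neg (not_not.mpr ha), rhoOn]

lemma rhoOn_eq_zero_iff {S : Finset (Fin n)} {h : V} : rhoOn l S h = 0 ↔ h ∈ flatOf l S := by
  classical
  rw [rhoOn, Finset.card_eq_zero, Finset.filter_eq_empty_iff, mem_flatOf]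
  simp

lemma rhoOn_add_rhoOn_sdiff {S T : Finset (Fin n)} (hT : T ⊆ S) (h : V) :
    rhoOn l T h + rhoOn l (S \ T) h = rhoOn l S h := by
  classical
  have hd : Disjoint (T.filter fun i => l i h ≠ 0) ((S \ T).filter fun i => l i h ≠ 0) :=
    Finset.disjoint_filter_filter Finset.disjoint_sdiff
  rw [rhoOn, rhoOn, ← Finset.card_union_of_disjoint hd, ← Finset.filter_union,
    Finset.union_sdiff_of_subset hT, rhoOn]

lemma semiBound_insert_of_ne {a : Fin n} {S I : Finset (Fin n)} (haS : a ∉ S) {h : V}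
    (ha : l a h ≠ 0) : semiBound l (insert a S) I h ≤ semiBound l S I h + 1 := by
  rw [semiBound, semiBound, rhoOn_insert_of_ne haS ha]
  omega

lemma semiBound_insert_of_eq {a : Fin n} {S I : Finset (Fin n)} {h : V} (ha : l a h = 0) :
    semiBound l (insert a S) I h = semiBound l S I h := by
  rw [semiBound, semiBound, rhoOn_insert_of_eq ha]

lemma semiBound_le_rhoOn (S I : Finset (Fin n)) (h : V) : semiBound l S I h ≤ rhoOn l S h :=
  Nat.sub_le _ _

@[simp] lemma semiBound_empty (S : Finset (Fin n)) (h : V) : semiBound l S ∅ h = rhoOn l S h := by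
  simp [semiBound]

lemma prodForm_mem_boundedForms {U : Submodule ℂ V} {T : Finset (Fin n)} {μ : U → ℕ}
    (hμ : ∀ h : U, h ≠ 0 → rhoOn l T (h : V) < μ h) :
    prodForm l U T ∈ boundedForms U μ T.card := by
  classical
  refine ⟨prodForm_mem_polyFun U T, fun h hh x => ?_, fun c hc x => ?_⟩
  · refine ⟨∏ i ∈ T, (Polynomial.C (l i h) * Polynomial.X + Polynomial.C (l i x)), ?_, fun t => ?_⟩
    · rw [Polynomial.mem_degreeLT]
      refine lt_of_le_of_lt ((Polynomial.degree_prod_le _ _).trans ?_)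
        (Nat.cast_lt.mpr (hμ h hh))
      rw [rhoOn, Finset.card_filter, Nat.cast_sum]
      refine Finset.sum_le_sum fun i _ => ?_
      split_ifs with hi
      · exact_mod_cast Polynomial.degree_linear_le
      · rw [not_not] at hi
        simpa [hi] using Polynomial.degree_C_le
    · simp [prodForm, Polynomial.eval_prod, mul_comm t, add_comm]
  · simp [prodForm, Finset.prod_mul_distrib]

lemma productSpan_le_boundedForms {π : Submodule ℂ V → Prop} {U : Submodule ℂ V}
    {S : Finset (Fin n)} {μ : U → ℕ}
    (hμ : ∀ T ⊆ S, π (U ⊓ flatOf l (S \ T)) → ∀ h : U, h ≠ 0 → rhoOn l T (h : V) < μ h) (i : ℤ) :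
    productSpan l π U S i ≤ boundedForms U μ i := by
  refine Submodule.span_le.mpr ?_
  rintro _ ⟨T, ⟨hT, rfl, hπ⟩, rfl⟩
  exact prodForm_mem_boundedForms (hμ T hT hπ)

variable (l)

lemma subsetWeight_congr {φ ψ : Submodule ℂ V → LaurentSeries ℚ} {U : Submodule ℂ V}
    {S : Finset (Fin n)} (h : ∀ T ⊆ S, φ (U ⊓ flatOf l T) = ψ (U ⊓ flatOf l T)) :
    subsetWeight l φ U S = subsetWeight l ψ U S := by
  refine Finset.sum_congr rfl fun T hT => ?_
  rw [h T (Finset.mem_powerset.mp hT)]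

lemma finrank_span_one_le {X : Type*} :
    FiniteDimensional ℂ (Submodule.span ℂ {fun _ : X => (1 : ℂ)}) ∧
    finrank ℂ (Submodule.span ℂ {fun _ : X => (1 : ℂ)}) ≤ 1 :=
  ⟨inferInstance, (finrank_span_le_card _).trans (by simp)⟩

lemma finrank_boundedForms_le_coeff_one {W : Type*} [AddCommGroup W] [Module ℂ W] {μ : W → ℕ}
    (hμ : ∀ h, h ≠ 0 → μ h ≤ 1) (i : ℤ) :
    FiniteDimensional ℂ (boundedForms W μ i) ∧
      (finrank ℂ (boundedForms W μ i) : ℚ) ≤ (1 : LaurentSeries ℚ).coeff i := by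
  have h1 := boundedForms_le_span_one hμ i
  rw [HahnSeries.coeff_one]
  split_ifs at h1 ⊢ with hi
  · refine ⟨Submodule.finiteDimensional_of_le h1, ?_⟩
    exact_mod_cast (Submodule.finrank_mono h1).trans finrank_span_one_le.2
  · rw [le_bot_iff.mp h1]
    exact ⟨inferInstance, by simp⟩

/-- Deletion and restriction bound the dimension of an external space. -/
lemma finrank_externalForms_le [FiniteDimensional ℂ V] (S : Finset (Fin n)) (U : Submodule ℂ V)
    (i : ℤ) :
    FiniteDimensional ℂ (boundedForms U (fun h => rhoOn l S h + 1) i) ∧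
      (finrank ℂ (boundedForms U (fun h => rhoOn l S h + 1) i) : ℚ) ≤
        (subsetWeight l (fun _ => 1) U S).coeff i := by
  induction S using Finset.induction_on generalizing U i with
  | empty =>
    rw [subsetWeight_empty]
    exact finrank_boundedForms_le_coeff_one (fun h _ => by simp [rhoOn]) i
  | insert a S haS ih =>
    by_cases ha : U ≤ LinearMap.ker (l a)
    · rw [subsetWeight_insert_of_le l _ U haS ha]
      have h1 : (fun h : U => rhoOn l (insert a S) h + 1) = fun h : U => rhoOn l S h + 1 :=
        funext fun h => by rw [rhoOn_insert_of_eq (ha h.2)]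
      rw [h1]
      exact ih U i
    · rw [subsetWeight_insert l _ U haS ha, HahnSeries.coeff_add, coeff_qVar_mul]
      have h1 : (fun h : ↥(U ⊓ LinearMap.ker (l a)) =>
          rhoOn l (insert a S) (Submodule.inclusion (inf_le_left : _ ≤ U) h : U) + 1) =
          fun h : ↥(U ⊓ LinearMap.ker (l a)) => rhoOn l S h + 1 :=
        funext fun h => by
          rw [Submodule.coe_inclusion, rhoOn_insert_of_eq h.2.2]
      have hC := ih (U ⊓ LinearMap.ker (l a)) i
      rw [← h1] at hC
      obtain ⟨h2, h3⟩ := finrank_boundedForms_le (domRestrict_ne_zero ha)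
        (Submodule.inclusion inf_le_left) (Submodule.inclusion_injective _)
        (fun x hx => ⟨⟨x, x.2, hx⟩, rfl⟩)
        (μ := fun h : U => rhoOn l (insert a S) h + 1) (μ' := fun h : U => rhoOn l S h + 1)
        (fun h _ hh => (Nat.add_le_add_right (rhoOn_insert_of_ne haS hh).le 1))
        (fun h _ hh => (Nat.add_le_add_right (rhoOn_insert_of_eq hh).le 1)) i
        (ih U (i - 1)).1 hC.1
      refine ⟨h2, le_trans ?_ (add_le_add (ih U (i - 1)).2 hC.2)⟩
      exact_mod_cast h3

/-- If some form in `I` is independent of the others on `U`, and the forms in `I` have no common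
zero in `U`, the summands for `T` and `insert a T` cancel. -/
lemma subsetWeight_semiWeight_eq_zero [FiniteDimensional ℂ V] {I : Finset (Fin n)}
    {U : Submodule ℂ V} (hI : U ⊓ flatOf l I = ⊥) {a : Fin n} (ha : a ∈ I) {h : V}
    (hh : h ∈ U ⊓ flatOf l (I.erase a)) (hah : l a h ≠ 0) :
    subsetWeight l (semiWeight l I) U I = 0 := by
  have hφ : ∀ D ≤ U, semiWeight l I D = (-qVar⁻¹) ^ finrank ℂ D := fun D hD =>
    if_pos (le_bot_iff.mp ((inf_le_inf_right _ hD).trans hI.le))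
  have hpow : I.powerset = (insert a (I.erase a)).powerset := by rw [Finset.insert_erase ha]
  rw [subsetWeight, hpow, Finset.sum_powerset_insert (Finset.notMem_erase a I),
    ← Finset.sum_add_distrib]
  refine Finset.sum_eq_zero fun T hT => ?_
  rw [Finset.mem_powerset] at hT
  have haT : a ∉ T := fun h => Finset.notMem_erase a I (hT h)
  have hle : ¬ U ⊓ flatOf l T ≤ LinearMap.ker (l a) := fun hle =>
    hah (hle ⟨hh.1, flatOf_anti l hT hh.2⟩)
  have hD := finrank_inf_ker_add_one _ hle
  have hDe : U ⊓ flatOf l (insert a T) = U ⊓ flatOf l T ⊓ LinearMap.ker (l a) := by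
    rw [flatOf_insert, inf_comm (LinearMap.ker _), inf_assoc]
  rw [hφ _ inf_le_left, hφ _ inf_le_left, hDe, ← hD, Finset.card_insert_of_notMem haT]
  have e1 : (I.card : ℤ) - T.card =
      (I.card - (T.card + 1 : ℕ)) + 1 := by
    push_cast
    ring
  have e2 (m k : ℤ) : ((T.card + 1 : ℕ) : ℤ) + m - k = T.card + (m + 1) - k := by
    push_cast
    ring
  rw [e1, e2, zpow_add_one₀ qVar_ne_zero]
  push_cast
  rw [pow_succ]
  have := qVar_ne_zero
  field_simp
  ring

/-- Deletion and restriction bound the dimension of a semi-internal space. When only the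
distinguished forms are left and they are independent on `U`, the space is zero: a direction on
which a single form does not vanish has degree bound zero. -/
lemma finrank_semiForms_le [FiniteDimensional ℂ V] (S I : Finset (Fin n)) (hIS : I ⊆ S)
    (U : Submodule ℂ V) (i : ℤ) :
    FiniteDimensional ℂ (boundedForms U (fun h => semiBound l S I h) i) ∧
      (finrank ℂ (boundedForms U (fun h => semiBound l S I h) i) : ℚ) ≤
        (subsetWeight l (semiWeight l I) U S).coeff i := by
  classical
  induction hm : S.card + I.card using Nat.strong_induction_on generalizing S I U i with
  | _ m ihm =>
  subst hm
  by_cases hSI : ∃ a ∈ S, a ∉ I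
  · obtain ⟨a, haS', haI⟩ := hSI
    obtain ⟨S, haS, rfl⟩ : ∃ S', a ∉ S' ∧ insert a S' = S :=
      ⟨S.erase a, Finset.notMem_erase a S, Finset.insert_erase haS'⟩
    have hIS' : I ⊆ S := fun x hx => (Finset.mem_insert.mp (hIS hx)).resolve_left fun h =>
      haI (h ▸ hx)
    have ih : ∀ U i, _ := fun U i => ihm (S.card + I.card)
      (by rw [Finset.card_insert_of_notMem haS]; omega) S I hIS' U i rfl
    by_cases ha : U ≤ LinearMap.ker (l a)
    · rw [subsetWeight_insert_of_le l _ U haS ha]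
      have h1 : (fun h : U => semiBound l (insert a S) I h) = fun h : U => semiBound l S I h :=
        funext fun h => semiBound_insert_of_eq (ha h.2)
      rw [h1]
      exact ih U i
    · rw [subsetWeight_insert l _ U haS ha, HahnSeries.coeff_add, coeff_qVar_mul]
      have h1 : (fun h : ↥(U ⊓ LinearMap.ker (l a)) =>
          semiBound l (insert a S) I (Submodule.inclusion (inf_le_left : _ ≤ U) h : U)) =
          fun h : ↥(U ⊓ LinearMap.ker (l a)) => semiBound l S I h :=
        funext fun h => by
          rw [Submodule.coe_inclusion, semiBound_insert_of_eq h.2.2]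
      have hC := ih (U ⊓ LinearMap.ker (l a)) i
      rw [← h1] at hC
      obtain ⟨h2, h3⟩ := finrank_boundedForms_le (domRestrict_ne_zero ha)
        (Submodule.inclusion inf_le_left) (Submodule.inclusion_injective _)
        (fun x hx => ⟨⟨x, x.2, hx⟩, rfl⟩)
        (μ := fun h : U => semiBound l (insert a S) I h) (μ' := fun h : U => semiBound l S I h)
        (fun h _ hh => semiBound_insert_of_ne haS hh)
        (fun h _ hh => (semiBound_insert_of_eq hh).le) i (ih U (i - 1)).1 hC.1
      refine ⟨h2, le_trans ?_ (add_le_add (ih U (i - 1)).2 hC.2)⟩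
      exact_mod_cast h3
  · push Not at hSI
    obtain rfl : I = S := Finset.Subset.antisymm hIS hSI
    by_cases hred : ∃ a ∈ I, U ⊓ flatOf l (I.erase a) = U ⊓ flatOf l I
    · -- a redundant form may be dropped from `I`, keeping it in the arrangement
      obtain ⟨a, ha, hae⟩ := hred
      have ih := ihm (I.card + (I.erase a).card)
        (by have := Finset.card_erase_lt_of_mem ha; omega) I (I.erase a) (Finset.erase_subset a I)
        U i rfl
      have h1 : (fun h : U => semiBound l I (I.erase a) h) = fun h : U => semiBound l I I h := by
        funext h
        have h2 : (h : V) ∈ flatOf l (I.erase a) ↔ (h : V) ∈ flatOf l I := by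
          have := SetLike.ext_iff.mp hae (h : V)
          simpa using this
        simp only [semiBound, h2]
      have h2 : subsetWeight l (semiWeight l (I.erase a)) U I =
          subsetWeight l (semiWeight l I) U I := by
        refine subsetWeight_congr l fun T _ => ?_
        have h3 : U ⊓ flatOf l T ⊓ flatOf l (I.erase a) = U ⊓ flatOf l T ⊓ flatOf l I := by
          rw [inf_right_comm, hae, inf_right_comm]
        simp only [semiWeight, h3]
      rw [h1, h2] at ih
      exact ih
    · push Not at hred
      by_cases hbot : U ⊓ flatOf l I = ⊥
      · rcases I.eq_empty_or_nonempty with rfl | ⟨a, ha⟩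
        · have hU : U = ⊥ := by simpa using hbot
          subst hU
          have h1 : subsetWeight l (semiWeight l ∅) ⊥ ∅ = 1 := by
            rw [subsetWeight_empty, semiWeight, if_pos (by simp)]
            simp
          rw [h1]
          exact finrank_boundedForms_le_coeff_one
            (fun h hh => absurd (Subsingleton.elim h 0) hh) i
        · -- along the line cut out by `I.erase a` only `l a` does not vanish
          obtain ⟨h, hh, hh0⟩ := (Submodule.ne_bot_iff _).mp (hbot ▸ hred a ha)
          have hah : l a h ≠ 0 := by
            intro h0
            have : h ∈ U ⊓ flatOf l I := by
              refine ⟨hh.1, mem_flatOf.mpr fun j hj => ?_⟩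
              rcases eq_or_ne j a with rfl | hja
              · exact h0
              · exact mem_flatOf.mp hh.2 j (Finset.mem_erase.mpr ⟨hja, hj⟩)
            rw [hbot] at this
            exact hh0 ((Submodule.mem_bot ℂ).mp this)
          have hb : semiBound l I I h = 0 := by
            have h1 : rhoOn l I h = 1 := by
              conv_lhs => rw [← Finset.insert_erase ha]
              rw [rhoOn_insert_of_ne (Finset.notMem_erase a I) hah, rhoOn_eq_zero_iff.mpr hh.2]
            have h2 : h ∉ flatOf l I := fun h3 => hah (mem_flatOf.mp h3 a ha)
            simp [semiBound, h1, h2]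
          have hB : boundedForms U (fun h => semiBound l I I h) i = ⊥ :=
            (Submodule.eq_bot_iff _).mpr fun f hf =>
              eq_zero_of_mem_boundedForms hf (h := ⟨h, hh.1⟩)
                (fun h0 => hh0 (congrArg Subtype.val h0)) hb
          rw [hB, subsetWeight_semiWeight_eq_zero l hbot ha hh hah]
          exact ⟨inferInstance, by simp⟩
      · -- a common zero `h` of all forms has degree bound zero
        obtain ⟨h, hh, hh0⟩ := (Submodule.ne_bot_iff _).mp hbot
        have hb : semiBound l I I h = 0 := by
          rw [semiBound, rhoOn_eq_zero_iff.mpr hh.2, Nat.zero_sub]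
        have hB : boundedForms U (fun h => semiBound l I I h) i = ⊥ :=
          (Submodule.eq_bot_iff _).mpr fun f hf =>
            eq_zero_of_mem_boundedForms hf (h := ⟨h, hh.1⟩)
              (fun h0 => hh0 (congrArg Subtype.val h0)) hb
        have hW : subsetWeight l (semiWeight l I) U I = 0 := by
          refine Finset.sum_eq_zero fun T hT => ?_
          have h3 : ¬ U ⊓ flatOf l T ⊓ flatOf l I = ⊥ := fun h3 => hh0 <| by
            have : h ∈ U ⊓ flatOf l T ⊓ flatOf l I :=
              ⟨⟨hh.1, flatOf_anti l (Finset.mem_powerset.mp hT) hh.2⟩, hh.2⟩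
            rw [h3] at this
            exact (Submodule.mem_bot ℂ).mp this
          rw [semiWeight, if_neg h3, zero_mul, zero_mul]
        rw [hB, hW]
        exact ⟨inferInstance, by simp⟩

/-! ### The external and central spaces -/

lemma externalForms_eq_productSpan [FiniteDimensional ℂ V] (S : Finset (Fin n))
    (U : Submodule ℂ V) (i : ℤ) :
    boundedForms U (fun h => rhoOn l S h + 1) i = productSpan l (fun _ => True) U S i ∧
      (finrank ℂ (boundedForms U (fun h => rhoOn l S h + 1) i) : ℚ) =
        (subsetWeight l (fun _ => 1) U S).coeff i := by
  classical
  have hle : productSpan l (fun _ => True) U S i ≤ boundedForms U (fun h => rhoOn l S h + 1) i :=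
    productSpan_le_boundedForms (fun T hT _ h _ => by
      have := rhoOn_add_rhoOn_sdiff (l := l) hT (h : V)
      omega) i
  obtain ⟨hfin, h1⟩ := finrank_externalForms_le l S U i
  have h2 := coeff_subsetWeight_le_finrank_productSpan l (fun _ => True) S U i
  rw [subsetWeight_congr l (ψ := fun _ => 1) fun T _ => if_pos trivial] at h2
  have h3 := Submodule.finrank_mono hle
  have h4 : finrank ℂ (boundedForms U (fun h => rhoOn l S h + 1) i) ≤
      finrank ℂ (productSpan l (fun _ => True) U S i) := by exact_mod_cast h1.trans h2
  exact ⟨(Submodule.eq_of_le_of_finrank_le hle h4).symm,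
    le_antisymm h1 (h2.trans (by exact_mod_cast h3))⟩

lemma centralForms_eq_productSpan [FiniteDimensional ℂ V] (S : Finset (Fin n))
    (U : Submodule ℂ V) (i : ℤ) :
    boundedForms U (fun h => rhoOn l S h) i = productSpan l (fun D => D = ⊥) U S i ∧
      (finrank ℂ (boundedForms U (fun h => rhoOn l S h) i) : ℚ) =
        (subsetWeight l (semiWeight l ∅) U S).coeff i := by
  classical
  have hle : productSpan l (fun D => D = ⊥) U S i ≤ boundedForms U (fun h => rhoOn l S h) i :=
    productSpan_le_boundedForms (fun T hT hπ h hh => by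
      have h1 := rhoOn_add_rhoOn_sdiff (l := l) hT (h : V)
      have h2 : rhoOn l (S \ T) (h : V) ≠ 0 := fun h0 => hh <| by
        have : (h : V) ∈ U ⊓ flatOf l (S \ T) := ⟨h.2, rhoOn_eq_zero_iff.mp h0⟩
        rw [hπ] at this
        exact Subtype.ext ((Submodule.mem_bot ℂ).mp this)
      omega) i
  obtain ⟨hfin, h1⟩ := finrank_semiForms_le l S ∅ (Finset.empty_subset S) U i
  have hμ : (fun h : U => semiBound l S ∅ h) = fun h : U => rhoOn l S h :=
    funext fun h => semiBound_empty S (h : V)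
  rw [hμ] at hfin h1
  have h2 := coeff_subsetWeight_le_finrank_productSpan l (fun D => D = ⊥) S U i
  rw [subsetWeight_congr l (ψ := semiWeight l ∅) fun T _ => by
    by_cases hD : U ⊓ flatOf l T = ⊥
    · rw [hD, semiWeight, if_pos rfl, if_pos (by simp), finrank_bot, pow_zero]
    · rw [if_neg hD, semiWeight, if_neg (by simpa using hD)]] at h2
  have h3 := Submodule.finrank_mono hle
  have h4 : finrank ℂ (boundedForms U (fun h => rhoOn l S h) i) ≤
      finrank ℂ (productSpan l (fun D => D = ⊥) U S i) := by exact_mod_cast h1.trans h2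
  exact ⟨(Submodule.eq_of_le_of_finrank_le hle h4).symm,
    le_antisymm h1 (h2.trans (by exact_mod_cast h3))⟩

end Bounds

/-! ### Commuting operators -/

section Operators

variable {M : Type*} [AddCommGroup M] [Module ℂ M]

lemma apply_add_smul_pow (A B : Module.End ℂ M) (hAB : Commute A B) (f : M) (lam : Dual ℂ M)
    (k : ℕ) (t : ℂ) : lam (((B + t • A) ^ k) f) =
      (∑ j ∈ Finset.range (k + 1),
        Polynomial.monomial j (lam ((B ^ (k - j) * A ^ j) f) * (k.choose j : ℂ))).eval t := by
  have h : Commute (t • A) B := hAB.smul_left t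
  rw [add_comm B, h.add_pow, LinearMap.sum_apply, map_sum, Polynomial.eval_finsetSum]
  refine Finset.sum_congr rfl fun j _ => ?_
  rw [Polynomial.eval_monomial, smul_pow, smul_mul_assoc, smul_mul_assoc, LinearMap.smul_apply,
    map_smul, ← nsmul_eq_mul', LinearMap.smul_apply, map_nsmul, (hAB.pow_pow j (k - j)).eq]
  simp only [smul_eq_mul, nsmul_eq_mul]
  ring

/-- Let `A`, `B` commute, let `A ^ ρ` kill `f`, and suppose that for every scalar `z` the power of
`B + z A` needed to kill `f` is smaller than the generic value `N + ρ` by the multiplicity `m_z`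
of `z` in a list of `ρ` scalars. Then `B ^ N * A ^ (ρ - 1)` kills `f`: after applying a linear
functional, `z ↦ (B + z A) ^ (N + ρ - 1) f` is a polynomial of degree less than `ρ` with `ρ` roots,
hence zero, and the vector in question is its top coefficient. -/
lemma pow_apply_pow_apply_eq_zero (A B : Module.End ℂ M) (hAB : Commute A B) (f : M)
    {κ : Type*} (R : Finset κ) (c : κ → ℂ) (N : ℕ) (hR : 0 < R.card) (hA : (A ^ R.card) f = 0)
    (hB : ∀ z : ℂ, ((B + z • A) ^ (N + (R.card - (R.val.map c).count z))) f = 0) :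
    (B ^ N) ((A ^ (R.card - 1)) f) = 0 := by
  refine (Module.forall_dual_apply_eq_zero_iff ℂ _).mp fun lam => ?_
  set k := N + R.card - 1 with hk
  -- `Q` is the polynomial `z ↦ lam ((B + z A) ^ k f)`
  set Q := ∑ j ∈ Finset.range (k + 1),
        Polynomial.monomial j (lam ((B ^ (k - j) * A ^ j) f) * (k.choose j : ℂ)) with hQ
  have hcoeff : ∀ j, Q.coeff j = if j < k + 1 then
      lam ((B ^ (k - j) * A ^ j) f) * (k.choose j : ℂ) else 0 := by
    intro j
    simp [hQ, Polynomial.finsetSum_coeff, Polynomial.coeff_monomial]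
  have hdvd : ∀ z, (Polynomial.X - Polynomial.C z) ^ ((R.val.map c).count z) ∣ Q := by
    intro z
    have hAB' : Commute A (B + z • A) := hAB.add_right ((Commute.refl A).smul_right z)
    have hshift : Q.comp (Polynomial.X + Polynomial.C z) = ∑ j ∈ Finset.range (k + 1),
        Polynomial.monomial j (lam (((B + z • A) ^ (k - j) * A ^ j) f) * (k.choose j : ℂ)) := by
      refine Polynomial.funext fun t => ?_
      rw [← apply_add_smul_pow A (B + z • A) hAB' f lam k t, Polynomial.eval_comp, hQ,
        ← apply_add_smul_pow A B hAB f lam k]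
      simp [add_smul, add_assoc, add_comm (t • A)]
    have hX : Polynomial.X ^ ((R.val.map c).count z) ∣ Q.comp (Polynomial.X + Polynomial.C z) := by
      rw [Polynomial.X_pow_dvd_iff]
      intro d hd
      have hcard : (R.val.map c).count z ≤ R.card := by
        simpa using Multiset.count_le_card z (R.val.map c)
      have h0 : ((B + z • A) ^ (k - d) * A ^ d) f = 0 := by
        have hsplit : k - d = (k - d - (N + (R.card - (R.val.map c).count z))) +
            (N + (R.card - (R.val.map c).count z)) := by omega
        rw [← (hAB'.pow_pow d (k - d)).eq, hsplit, pow_add, Module.End.mul_apply,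
          Module.End.mul_apply, hB z, map_zero, map_zero]
      rw [Module.End.mul_apply] at h0
      rw [hshift]
      simp [Polynomial.finsetSum_coeff, Polynomial.coeff_monomial, h0]
    obtain ⟨S, hS⟩ := hX
    refine ⟨S.comp (Polynomial.X - Polynomial.C z), ?_⟩
    have h1 := congrArg (fun p => Polynomial.comp p (Polynomial.X - Polynomial.C z)) hS
    simpa [Polynomial.comp_assoc] using h1
  have hQ0 : Q = 0 := by
    by_contra hne
    have h1 : R.val.map c ≤ Q.roots := by
      rw [Multiset.le_iff_count]
      intro z
      rw [Polynomial.count_roots]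
      exact (Polynomial.le_rootMultiplicity_iff hne).mpr (hdvd z)
    have h2 := (Multiset.card_le_card h1).trans (Polynomial.card_roots' Q)
    rw [Multiset.card_map, Finset.card_val] at h2
    have h3 : Q.natDegree ≤ R.card - 1 := by
      rw [Polynomial.natDegree_le_iff_coeff_eq_zero]
      intro j hj
      have hsplit : j = (j - R.card) + R.card := by omega
      have h0 : (B ^ (k - j) * A ^ j) f = 0 := by
        rw [hsplit, pow_add, Module.End.mul_apply, Module.End.mul_apply, hA, map_zero, map_zero]
      rw [hcoeff, h0]
      simp
    omega
  have h4 := hcoeff (R.card - 1)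
  rw [hQ0, Polynomial.coeff_zero, if_pos (by omega)] at h4
  have h5 : k - (R.card - 1) = N := by omega
  rw [h5] at h4
  have h6 : (k.choose (R.card - 1) : ℂ) ≠ 0 := by
    exact_mod_cast (Nat.choose_pos (by omega)).ne'
  exact (mul_eq_zero.mp h4.symm).resolve_right h6

end Operators

/-! ### Polynomials in coordinates -/

section Coordinates

variable {V : Type*} [AddCommGroup V] [Module ℂ V] {ι : Type*} (b : Basis ι ℂ V)

/-- The polynomial in one variable obtained by restricting a polynomial in coordinates to the line
`t ↦ x + t • h`. -/
def linePoly (x h : V) : MvPolynomial ι ℂ →ₐ[ℂ] Polynomial ℂ :=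
  MvPolynomial.aeval fun i => Polynomial.C (b.repr x i) + Polynomial.C (b.repr h i) * Polynomial.X

/-- The function on a subspace `U` given by a polynomial in coordinates. -/
def evalOn (U : Submodule ℂ V) : MvPolynomial ι ℂ →ₗ[ℂ] (U → ℂ) where
  toFun F := fun x => MvPolynomial.eval (fun i => b.repr (x : V) i) F
  map_add' _ _ := by
    funext x
    simp
  map_smul' _ _ := by
    funext x
    simp

variable {b}

lemma eval_linePoly (x h : V) (F : MvPolynomial ι ℂ) (t : ℂ) :
    (linePoly b x h F).eval t = MvPolynomial.eval (fun i => b.repr (x + t • h) i) F := by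
  induction F using MvPolynomial.induction_on with
  | C a => simp [linePoly]
  | add p q hp hq => simp only [map_add, Polynomial.eval_add, hp, hq]
  | mul_X p i hp =>
    rw [map_mul, Polynomial.eval_mul, hp]
    simp [linePoly, mul_comm t]

lemma evalOn_apply (U : Submodule ℂ V) (F : MvPolynomial ι ℂ) (x : U) :
    evalOn b U F x = MvPolynomial.eval (fun i => b.repr (x : V) i) F := rfl

lemma evalOn_mem_polyFun (U : Submodule ℂ V) (F : MvPolynomial ι ℂ) :
    evalOn b U F ∈ polyFun U := by
  induction F using MvPolynomial.induction_on with
  | C a =>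
    have : evalOn b U (MvPolynomial.C a) = fun _ => a := by
      funext x
      simp [evalOn_apply]
    rw [this]
    exact (polyFun U).algebraMap_mem a
  | add p q hp hq =>
    rw [map_add]
    exact add_mem hp hq
  | mul_X p i hp =>
    have : evalOn b U (p * MvPolynomial.X i) = evalOn b U p * ((b.coord i).domRestrict U) := by
      funext x
      simp [evalOn_apply]
    rw [this]
    exact mul_mem hp (coe_dual_mem_polyFun _)

lemma eval_smul_of_isHomogeneous {F : MvPolynomial ι ℂ} {k : ℕ} (hF : F.IsHomogeneous k) (c : ℂ)
    (y : ι → ℂ) : MvPolynomial.eval (c • y) F = c ^ k * MvPolynomial.eval y F := by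
  rw [MvPolynomial.eval_eq, MvPolynomial.eval_eq, Finset.mul_sum]
  refine Finset.sum_congr rfl fun d hd => ?_
  have hk : ∑ i ∈ d.support, d i = k := by
    have := hF (MvPolynomial.mem_support_iff.mp hd)
    rwa [Finsupp.weight_apply, Finsupp.sum,
      Finset.sum_congr rfl (g := fun i => d i) (by simp)] at this
  simp only [Pi.smul_apply, smul_eq_mul, mul_pow, Finset.prod_mul_distrib,
    Finset.prod_pow_eq_pow_sum, hk]
  ring

lemma isHomogeneous_of_eval_smul {F : MvPolynomial ι ℂ} {k : ℕ}
    (hF : ∀ c : ℂ, c ≠ 0 → ∀ y, MvPolynomial.eval (c • y) F = c ^ k * MvPolynomial.eval y F) :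
    F.IsHomogeneous k := by
  have hcomp : ∀ j, j ≠ k → MvPolynomial.homogeneousComponent j F = 0 := by
    intro j hj
    refine MvPolynomial.funext fun y => ?_
    rw [map_zero]
    let P : Polynomial ℂ := ∑ i ∈ Finset.range (F.totalDegree + 1),
      Polynomial.monomial i (MvPolynomial.eval y (MvPolynomial.homogeneousComponent i F))
    let Q : Polynomial ℂ := Polynomial.monomial k (MvPolynomial.eval y F)
    have hPQ : P = Q := by
      refine Polynomial.eq_of_infinite_eval_eq P Q
        ((Set.finite_singleton (0 : ℂ)).infinite_compl.mono fun c hc => ?_)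
      have h1 := hF c hc y
      have h2 : MvPolynomial.eval (c • y) F = P.eval c := by
        conv_lhs => rw [← MvPolynomial.sum_homogeneousComponent F]
        rw [map_sum, Polynomial.eval_finsetSum]
        refine Finset.sum_congr rfl fun i _ => ?_
        rw [eval_smul_of_isHomogeneous (MvPolynomial.homogeneousComponent_isHomogeneous i F),
          Polynomial.eval_monomial, mul_comm]
      rw [h2] at h1
      simp only [Set.mem_ofPred_eq, h1, Q, Polynomial.eval_monomial, mul_comm]
    by_cases hjd : j < F.totalDegree + 1
    · have h3 := congrArg (fun p => Polynomial.coeff p j) hPQ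
      simpa [P, Q, Polynomial.finsetSum_coeff, Polynomial.coeff_monomial, hjd, hj.symm] using h3
    · rw [MvPolynomial.homogeneousComponent_eq_zero _ _ (by omega), map_zero]
  have hsum := MvPolynomial.sum_homogeneousComponent F
  have h4 : F = MvPolynomial.homogeneousComponent k F := by
    by_cases hk : k < F.totalDegree + 1
    · conv_lhs => rw [← hsum]
      exact Finset.sum_eq_single_of_mem k (Finset.mem_range.mpr hk) fun j _ hj => hcomp j hj
    · have hF0 : F = 0 := by
        rw [← hsum]
        refine Finset.sum_eq_zero fun j hj => hcomp j ?_
        have := Finset.mem_range.mp hj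
        omega
      rw [hF0, map_zero]
  rw [h4]
  exact MvPolynomial.homogeneousComponent_isHomogeneous k F

variable [Fintype ι]

lemma dirDeriv_apply (h : V) (F : MvPolynomial ι ℂ) :
    dirDeriv b h F = ∑ i, b.repr h i • MvPolynomial.pderiv i F := by
  simp [dirDeriv]

lemma dirDeriv_mul (h : V) (F G : MvPolynomial ι ℂ) :
    dirDeriv b h (F * G) = F * dirDeriv b h G + G * dirDeriv b h F := by
  simp only [dirDeriv_apply, Derivation.leibniz, smul_add, Finset.sum_add_distrib, Finset.mul_sum,
    smul_eq_mul, mul_smul_comm]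

lemma dirDeriv_X (h : V) (i : ι) :
    dirDeriv b h (MvPolynomial.X i) = MvPolynomial.C (b.repr h i) := by
  classical
  rw [dirDeriv_apply, Finset.sum_eq_single i]
  · rw [MvPolynomial.pderiv_X_self, MvPolynomial.smul_eq_C_mul, mul_one]
  · intro j _ hj
    rw [MvPolynomial.pderiv_X_of_ne hj.symm, smul_zero]
  · simp

lemma derivative_linePoly (x h : V) (F : MvPolynomial ι ℂ) :
    Polynomial.derivative (linePoly b x h F) = linePoly b x h (dirDeriv b h F) := by
  induction F using MvPolynomial.induction_on with
  | C a => simp [linePoly, dirDeriv_apply]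
  | add p q hp hq => simp only [map_add, hp, hq]
  | mul_X p i hp =>
    rw [map_mul, Polynomial.derivative_mul, hp, dirDeriv_mul, dirDeriv_X, map_add, map_mul, map_mul]
    simp only [linePoly, MvPolynomial.aeval_X, MvPolynomial.aeval_C, Polynomial.derivative_add,
      Polynomial.derivative_C, Polynomial.derivative_mul, Polynomial.derivative_X,
      Polynomial.algebraMap_eq]
    ring

lemma iterate_derivative_linePoly (x h : V) (F : MvPolynomial ι ℂ) (m : ℕ) :
    Polynomial.derivative^[m] (linePoly b x h F) = linePoly b x h ((dirDeriv b h ^ m) F) := by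
  induction m with
  | zero => simp
  | succ m ih =>
    rw [Function.iterate_succ_apply', ih, derivative_linePoly, pow_succ', Module.End.mul_apply]

lemma eq_zero_of_eval_repr {F : MvPolynomial ι ℂ}
    (h : ∀ x : V, MvPolynomial.eval (fun i => b.repr x i) F = 0) : F = 0 := by
  refine MvPolynomial.funext fun y => ?_
  have := h (b.equivFun.symm y)
  have h2 : (fun i => b.repr (b.equivFun.symm y) i) = y := by
    rw [← b.equivFun_apply, LinearEquiv.apply_symm_apply]
  rw [h2] at this
  simpa using this

/-- A power of a directional derivative kills a polynomial if and only if the degrees of its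
restrictions to the lines in that direction are smaller than the exponent. -/
lemma dirDeriv_pow_eq_zero_iff {h : V} {F : MvPolynomial ι ℂ} {m : ℕ} :
    (dirDeriv b h ^ m) F = 0 ↔ ∀ x, linePoly b x h F ∈ Polynomial.degreeLT ℂ m := by
  constructor
  · intro h0 x
    have h1 := iterate_derivative_linePoly (b := b) x h F m
    rw [h0, map_zero] at h1
    rw [Polynomial.mem_degreeLT, Polynomial.degree_lt_iff_coeff_zero]
    intro k hk
    have h2 := congrArg (fun p => Polynomial.coeff p (k - m)) h1
    simp only [Polynomial.coeff_iterate_derivative, Polynomial.coeff_zero, nsmul_eq_mul,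
      mul_eq_zero, Nat.cast_eq_zero, Nat.descFactorial_eq_zero_iff_lt, Nat.sub_add_cancel hk] at h2
    exact h2.resolve_left (by omega)
  · intro h0
    refine eq_zero_of_eval_repr (b := b) fun x => ?_
    have h1 := iterate_derivative_linePoly (b := b) x h F m
    rw [Polynomial.iterate_derivative_eq_zero_of_degree_lt
      (Polynomial.mem_degreeLT.mp (h0 x))] at h1
    have h2 := eval_linePoly (b := b) x h ((dirDeriv b h ^ m) F) 0
    rw [← h1] at h2
    simpa using h2.symm

lemma dirDeriv_add (h k : V) : dirDeriv b (h + k) = dirDeriv b h + dirDeriv b k := by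
  simp [dirDeriv, add_smul, Finset.sum_add_distrib]

lemma dirDeriv_smul (c : ℂ) (h : V) : dirDeriv b (c • h) = c • dirDeriv b h := by
  simp [dirDeriv, mul_smul, Finset.smul_sum]

lemma pderiv_comm_apply {ι : Type*} (i j : ι) (F : MvPolynomial ι ℂ) :
    MvPolynomial.pderiv i (MvPolynomial.pderiv j F) =
      MvPolynomial.pderiv j (MvPolynomial.pderiv i F) := by
  classical
  have h : ⁅MvPolynomial.pderiv (R := ℂ) i, MvPolynomial.pderiv (R := ℂ) j⁆ = 0 :=
    MvPolynomial.derivation_ext fun k => by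
      simp [Derivation.commutator_apply, MvPolynomial.pderiv_X, Pi.single_apply, apply_ite]
  have := congrArg (fun D => D F) h
  rw [Derivation.commutator_apply] at this
  exact sub_eq_zero.mp this

lemma dirDeriv_commute (h k : V) : Commute (dirDeriv b h) (dirDeriv b k) := by
  refine LinearMap.ext fun F => ?_
  simp only [Module.End.mul_apply, dirDeriv_apply, map_sum, map_smul, Finset.smul_sum]
  rw [Finset.sum_comm]
  refine Finset.sum_congr rfl fun i _ => Finset.sum_congr rfl fun j _ => ?_
  rw [smul_comm, pderiv_comm_apply]

lemma evalOn_top_injective : Function.Injective (evalOn b (⊤ : Submodule ℂ V)) := by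
  refine (injective_iff_map_eq_zero _).mpr fun F hF => ?_
  exact eq_zero_of_eval_repr (b := b) fun x => congrFun hF ⟨x, trivial⟩

lemma exists_evalOn_top_eq {f : (⊤ : Submodule ℂ V) → ℂ} (hf : f ∈ polyFun (⊤ : Submodule ℂ V)) :
    ∃ F, evalOn b ⊤ F = f := by
  induction hf using polyFun_induction with
  | hφ φ =>
    refine ⟨∑ i, MvPolynomial.C (φ ⟨b i, trivial⟩) * MvPolynomial.X i, ?_⟩
    funext x
    have hx : x = ∑ i, b.repr (x : V) i • (⟨b i, trivial⟩ : (⊤ : Submodule ℂ V)) := by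
      refine Subtype.ext ?_
      simp
    rw [evalOn_apply]
    conv_rhs => rw [hx]
    simp [mul_comm]
  | hc c => exact ⟨MvPolynomial.C c, funext fun x => by simp [evalOn_apply]⟩
  | hadd f g hf hg h1 h2 =>
    obtain ⟨F, rfl⟩ := h1
    obtain ⟨G, rfl⟩ := h2
    exact ⟨F + G, map_add _ _ _⟩
  | hmul f g hf hg h1 h2 =>
    obtain ⟨F, rfl⟩ := h1
    obtain ⟨G, rfl⟩ := h2
    exact ⟨F * G, funext fun x => by simp [evalOn_apply]⟩

end Coordinates

/-! ### Inverse systems as spaces of functions -/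

section InverseSystem

variable {V : Type*} [AddCommGroup V] [Module ℂ V] {ι : Type*} [Fintype ι] (b : Basis ι ℂ V)

/-- The homogeneous polynomials of degree `i` that are killed by the `μ h`-th power of the
directional derivative along `h`, for every nonzero `h`. -/
def inverseForms (μ : V → ℕ) (i : ℕ) : Submodule ℂ (MvPolynomial ι ℂ) :=
  (⨅ h : V, ⨅ _ : h ≠ 0, LinearMap.ker (dirDeriv b h ^ μ h)) ⊓
    MvPolynomial.homogeneousSubmodule ι ℂ i

variable {b}

lemma mem_inverseForms {μ : V → ℕ} {i : ℕ} {F : MvPolynomial ι ℂ} :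
    F ∈ inverseForms b μ i ↔ (∀ h : V, h ≠ 0 → (dirDeriv b h ^ μ h) F = 0) ∧ F.IsHomogeneous i := by
  simp [inverseForms, Submodule.mem_iInf, MvPolynomial.mem_homogeneousSubmodule]

lemma dirDeriv_pow_eq_zero_of_le {h : V} {F : MvPolynomial ι ℂ} {m k : ℕ} (hmk : m ≤ k)
    (hF : (dirDeriv b h ^ m) F = 0) : (dirDeriv b h ^ k) F = 0 := by
  rw [← Nat.sub_add_cancel hmk, pow_add, Module.End.mul_apply, hF, map_zero]

/-- A directional derivative lowers the degree of homogeneity by one. -/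
lemma eval_smul_dirDeriv {i : ℤ} {F : MvPolynomial ι ℂ}
    (hF : ∀ c : ℂ, c ≠ 0 → ∀ x : V, MvPolynomial.eval (fun j => b.repr (c • x) j) F =
      c ^ i * MvPolynomial.eval (fun j => b.repr x j) F) (h : V) (c : ℂ) (hc : c ≠ 0) (x : V) :
    MvPolynomial.eval (fun j => b.repr (c • x) j) (dirDeriv b h F) =
      c ^ (i - 1) * MvPolynomial.eval (fun j => b.repr x j) (dirDeriv b h F) := by
  have h1 : (linePoly b (c • x) h F).comp (Polynomial.C c * Polynomial.X) =
      Polynomial.C (c ^ i) * linePoly b x h F := by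
    refine Polynomial.funext fun t => ?_
    have h2 : c • x + (c * t) • h = c • (x + t • h) := by
      rw [smul_add, mul_smul]
    rw [Polynomial.eval_comp, Polynomial.eval_mul, eval_linePoly]
    simp only [Polynomial.eval_mul, Polynomial.eval_C, Polynomial.eval_X]
    rw [h2, hF c hc, eval_linePoly]
  have h3 := congrArg (fun p => (Polynomial.derivative p).eval 0) h1
  simp only [Polynomial.derivative_comp, Polynomial.derivative_mul, Polynomial.derivative_C,
    derivative_linePoly, Polynomial.derivative_X, Polynomial.eval_mul,
    Polynomial.eval_comp, Polynomial.eval_C, Polynomial.eval_X, zero_mul, zero_add, mul_one,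
    mul_zero, eval_linePoly, zero_smul, add_zero] at h3
  rw [zpow_sub_one₀ hc]
  field_simp
  linear_combination h3

lemma eval_smul_dirDeriv_pow {i : ℕ} {F : MvPolynomial ι ℂ} (hF : F.IsHomogeneous i) (h : V)
    (m : ℕ) (c : ℂ) (hc : c ≠ 0) (x : V) :
    MvPolynomial.eval (fun j => b.repr (c • x) j) ((dirDeriv b h ^ m) F) =
      c ^ ((i : ℤ) - m) * MvPolynomial.eval (fun j => b.repr x j) ((dirDeriv b h ^ m) F) := by
  induction m generalizing c x with
  | zero =>
    have := eval_smul_of_isHomogeneous hF c (fun j => b.repr x j)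
    simpa [Pi.smul_def] using this
  | succ m ih =>
    rw [pow_succ', Module.End.mul_apply, eval_smul_dirDeriv ih h c hc x]
    congr 2
    push_cast
    ring

lemma evalOn_mem_boundedForms {U : Submodule ℂ V} {μ : V → ℕ} {i : ℤ} {F : MvPolynomial ι ℂ}
    (h1 : ∀ h ∈ U, h ≠ 0 → (dirDeriv b h ^ μ h) F = 0)
    (h2 : ∀ c : ℂ, c ≠ 0 → ∀ x : V, MvPolynomial.eval (fun j => b.repr (c • x) j) F =
      c ^ i * MvPolynomial.eval (fun j => b.repr x j) F) :
    evalOn b U F ∈ boundedForms U (fun h => μ h) i := by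
  refine ⟨evalOn_mem_polyFun U F, fun h hh x => ⟨linePoly b (x : V) h F, ?_, fun t => ?_⟩,
    fun c hc x => h2 c hc x⟩
  · exact dirDeriv_pow_eq_zero_iff.mp (h1 h h.2 fun h0 => hh (Subtype.ext h0)) x
  · rw [eval_linePoly]
    rfl

lemma dirDeriv_pow_eq_zero_of_mem_boundedForms {μ : (⊤ : Submodule ℂ V) → ℕ} {i : ℤ}
    {F : MvPolynomial ι ℂ} (hF : evalOn b ⊤ F ∈ boundedForms (⊤ : Submodule ℂ V) μ i) {h : V}
    (hh : h ≠ 0) : (dirDeriv b h ^ μ ⟨h, trivial⟩) F = 0 := by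
  refine dirDeriv_pow_eq_zero_iff.mpr fun x => ?_
  obtain ⟨p, hp, hp'⟩ := hF.2.1 ⟨h, trivial⟩ (fun h0 => hh (congrArg Subtype.val h0)) ⟨x, trivial⟩
  have : linePoly b x h F = p := by
    refine Polynomial.funext fun t => ?_
    rw [← hp' t, eval_linePoly]
    rfl
  rwa [this]

lemma map_evalOn_inverseForms (μ : V → ℕ) (i : ℕ) :
    (inverseForms b μ i).map (evalOn b ⊤) =
      boundedForms (⊤ : Submodule ℂ V) (fun h => μ h) i := by
  refine le_antisymm ?_ fun f hf => ?_
  · rintro _ ⟨F, hF, rfl⟩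
    rw [SetLike.mem_coe, mem_inverseForms] at hF
    refine evalOn_mem_boundedForms (fun h _ hh => hF.1 h hh) fun c hc x => ?_
    have := eval_smul_dirDeriv_pow (b := b) hF.2 0 0 c hc x
    simpa using this
  · obtain ⟨F, rfl⟩ := exists_evalOn_top_eq (b := b) hf.1
    refine ⟨F, mem_inverseForms.mpr
      ⟨fun h hh => dirDeriv_pow_eq_zero_of_mem_boundedForms hf hh, ?_⟩, rfl⟩
    refine isHomogeneous_of_eval_smul fun c hc y => ?_
    have h1 := hf.2.2 c hc ⟨b.equivFun.symm y, trivial⟩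
    have h2 : ∀ z : ι → ℂ, (fun j => b.repr (b.equivFun.symm z) j) = z := fun z => by
      rw [← b.equivFun_apply, LinearEquiv.apply_symm_apply]
    rw [evalOn_apply, evalOn_apply] at h1
    simp only [Submodule.coe_smul, ← map_smul] at h1
    rw [h2, h2] at h1
    exact_mod_cast h1

lemma finrank_inverseForms (μ : V → ℕ) (i : ℕ) :
    finrank ℂ (inverseForms b μ i) =
      finrank ℂ (boundedForms (⊤ : Submodule ℂ V) (fun h => μ h) i) := by
  rw [← map_evalOn_inverseForms (b := b)]
  exact (Submodule.equivMapOfInjective _ evalOn_top_injective _).finrank_eq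

end InverseSystem

/-! ### Top derivatives along the lines of an arrangement -/

section Lines

variable {V : Type*} [AddCommGroup V] [Module ℂ V] {n : ℕ} (l : Fin n → Dual ℂ V)

open scoped Classical in
/-- The indices of the hyperplanes containing `h`. -/
def zeroSet (h : V) : Finset (Fin n) := Finset.univ.filter fun i => l i h = 0

open scoped Classical in
/-- The sets of indices of the hyperplanes containing a line which is an intersection of
hyperplanes of the arrangement, lies on all hyperplanes with index in `I`, and does not lie on the
hyperplane with index `e`. -/
def lineFlats (I : Finset (Fin n)) (e : Fin n) : Finset (Finset (Fin n)) :=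
  Finset.univ.filter fun F => I ⊆ F ∧ ∃ h, l e h ≠ 0 ∧ flatOf l F = Submodule.span ℂ {h} ∧
    F = zeroSet l h

variable {l}

lemma mem_zeroSet {h : V} {i : Fin n} : i ∈ zeroSet l h ↔ l i h = 0 := by
  simp [zeroSet]

lemma subset_zeroSet {h : V} {T : Finset (Fin n)} : T ⊆ zeroSet l h ↔ h ∈ flatOf l T :=
  ⟨fun hT => mem_flatOf.mpr fun _ hi => mem_zeroSet.mp (hT hi),
    fun hT _ hi => mem_zeroSet.mpr (mem_flatOf.mp hT _ hi)⟩

lemma mem_flatOf_zeroSet (h : V) : h ∈ flatOf l (zeroSet l h) :=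
  subset_zeroSet.mp (Finset.Subset.refl _)

lemma zeroSet_smul {c : ℂ} (hc : c ≠ 0) (h : V) : zeroSet l (c • h) = zeroSet l h := by
  ext i
  simp [mem_zeroSet, hc]

lemma rhoOn_univ_add_card_zeroSet (h : V) :
    rhoOn l Finset.univ h + (zeroSet l h).card = n := by
  classical
  have := Finset.card_filter_add_card_filter_not (s := (Finset.univ : Finset (Fin n)))
    (fun i => l i h = 0)
  rw [Finset.card_univ, Fintype.card_fin] at this
  rw [rhoOn, zeroSet, add_comm]
  convert this

lemma mem_lineFlats {I : Finset (Fin n)} {e : Fin n} {F : Finset (Fin n)} :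
    F ∈ lineFlats l I e ↔ I ⊆ F ∧ ∃ h, l e h ≠ 0 ∧ flatOf l F = Submodule.span ℂ {h} ∧
      F = zeroSet l h := by
  simp [lineFlats]

variable {ι : Type*} [Fintype ι] {b : Basis ι ℂ V}

/-- The top derivative of a semi-internal form along a direction `h₀` on which the distinguished
forms vanish satisfies the semi-internal degree bounds of the forms vanishing at `h₀`: the degree
bounds in the directions `h + z h₀` drop exactly for those `z` for which `h + z h₀` lies on further
hyperplanes, with multiplicities adding up to the number of forms not vanishing at `h₀`. -/
lemma dirDeriv_pow_semiBound_zeroSet {I : Finset (Fin n)} {i : ℕ} {G : MvPolynomial ι ℂ}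
    (hG : G ∈ inverseForms b (semiBound l Finset.univ I) i) {h₀ h : V} {e : Fin n}
    (hI : h₀ ∈ flatOf l I) (he : l e h₀ ≠ 0) (hh : h ≠ 0) (heh : l e h = 0) :
    (dirDeriv b h ^ semiBound l (zeroSet l h₀) I h)
      ((dirDeriv b h₀ ^ (rhoOn l Finset.univ h₀ - 1)) G) = 0 := by
  classical
  rw [mem_inverseForms] at hG
  have hh₀ : h₀ ≠ 0 := by
    rintro rfl
    simp at he
  let R := Finset.univ.filter fun i => l i h₀ ≠ 0
  have hRdef : R.card = rhoOn l Finset.univ h₀ := rfl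
  have hR : 0 < R.card := Finset.card_pos.mpr ⟨e, by simp [R, he]⟩
  rw [← hRdef]
  refine pow_apply_pow_apply_eq_zero (dirDeriv b h₀) (dirDeriv b h) (dirDeriv_commute _ _) G R
    (fun i => - l i h / l i h₀) _ hR ?_ fun z => ?_
  · have := hG.1 h₀ hh₀
    rwa [semiBound, if_pos hI, Nat.sub_zero] at this
  · rw [← dirDeriv_smul, ← dirDeriv_add]
    have hne : h + z • h₀ ≠ 0 := by
      intro h0
      have h1 := congrArg (l e) h0
      rw [map_add, heh, map_smul, zero_add, smul_eq_mul, map_zero] at h1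
      have hz : z = 0 := (mul_eq_zero.mp h1).resolve_right he
      rw [hz, zero_smul, add_zero] at h0
      exact hh h0
    refine dirDeriv_pow_eq_zero_of_le ?_ (hG.1 _ hne)
    have hIz : h + z • h₀ ∈ flatOf l I ↔ h ∈ flatOf l I :=
      Submodule.add_mem_iff_left _ (Submodule.smul_mem _ z hI)
    have hcount : (R.val.map fun i => - l i h / l i h₀).count z =
        (R.filter fun i => l i (h + z • h₀) = 0).card := by
      rw [Multiset.count_map, ← Finset.filter_val, Finset.card_val]
      congr 1
      refine Finset.filter_congr fun i hi => ?_
      have hi0 : l i h₀ ≠ 0 := (Finset.mem_filter.mp hi).2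
      rw [eq_div_iff hi0, map_add, map_smul, smul_eq_mul]
      constructor
      · intro h1
        linear_combination h1
      · intro h1
        linear_combination h1
    have hrho : rhoOn l Finset.univ (h + z • h₀) = rhoOn l (zeroSet l h₀) h +
        (R.card - (R.filter fun i => l i (h + z • h₀) = 0).card) := by
      have h1 := rhoOn_add_rhoOn_sdiff (l := l) (Finset.subset_univ (zeroSet l h₀)) (h + z • h₀)
      have h2 : Finset.univ \ zeroSet l h₀ = R := by
        ext i
        simp [R, mem_zeroSet]
      have h3 : rhoOn l (zeroSet l h₀) (h + z • h₀) = rhoOn l (zeroSet l h₀) h := by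
        rw [rhoOn, rhoOn]
        congr 1
        refine Finset.filter_congr fun i hi => ?_
        rw [map_add, map_smul, mem_zeroSet.mp hi, smul_zero, add_zero]
      have h4 := Finset.card_filter_add_card_filter_not (s := R)
        (fun i => l i (h + z • h₀) = 0)
      have h5 : rhoOn l R (h + z • h₀) = (R.filter fun i => ¬ l i (h + z • h₀) = 0).card := by
        rw [rhoOn]
      rw [h2, h3] at h1
      omega
    rw [hcount, semiBound, semiBound, hrho]
    simp only [hIz]
    split_ifs with hhI
    · omega
    · have : rhoOn l (zeroSet l h₀) h ≠ 0 := fun h0 =>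
        hhI (flatOf_anti l (subset_zeroSet.mpr hI) (rhoOn_eq_zero_iff.mp h0))
      omega

/-- If the top derivative of a semi-internal form along `h₀` vanishes on a hyperplane not
containing `h₀`, it vanishes identically, because it does not depend on the direction `h₀`. -/
lemma dirDeriv_pow_eq_zero_of_evalOn {I : Finset (Fin n)} {i : ℕ} {G : MvPolynomial ι ℂ}
    (hG : G ∈ inverseForms b (semiBound l Finset.univ I) i) {h₀ : V} {e : Fin n}
    (he : l e h₀ ≠ 0)
    (h0 : evalOn b (LinearMap.ker (l e)) ((dirDeriv b h₀ ^ (rhoOn l Finset.univ h₀ - 1)) G) = 0) :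
    (dirDeriv b h₀ ^ (rhoOn l Finset.univ h₀ - 1)) G = 0 := by
  classical
  have hh₀ : h₀ ≠ 0 := by
    rintro rfl
    simp at he
  have hpos : rhoOn l Finset.univ h₀ ≠ 0 := fun h =>
    he (mem_flatOf.mp (rhoOn_eq_zero_iff.mp h) e (Finset.mem_univ e))
  set P := (dirDeriv b h₀ ^ (rhoOn l Finset.univ h₀ - 1)) G with hP
  have h1 : (dirDeriv b h₀ ^ 1) P = 0 := by
    rw [hP, ← Module.End.mul_apply, ← pow_add]
    exact dirDeriv_pow_eq_zero_of_le ((semiBound_le_rhoOn _ _ _).trans (by omega))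
      ((mem_inverseForms.mp hG).1 h₀ hh₀)
  refine eq_zero_of_eval_repr (b := b) fun x => ?_
  have h2 := dirDeriv_pow_eq_zero_iff.mp h1 x
  have h3 : linePoly b x h₀ P = Polynomial.C ((linePoly b x h₀ P).coeff 0) := by
    rw [Polynomial.mem_degreeLT, Polynomial.degree_lt_iff_coeff_zero] at h2
    exact Polynomial.eq_C_of_natDegree_le_zero (Polynomial.natDegree_le_iff_coeff_eq_zero.mpr h2)
  have h4 := eval_linePoly (b := b) x h₀ P 0
  have h5 := eval_linePoly (b := b) x h₀ P (- (l e x / l e h₀))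
  rw [h3, Polynomial.eval_C] at h4 h5
  have h6 : x + (- (l e x / l e h₀)) • h₀ ∈ LinearMap.ker (l e) := by
    rw [LinearMap.mem_ker, map_add, map_smul, smul_eq_mul]
    field_simp
    ring
  have h7 := congrFun h0 ⟨_, h6⟩
  rw [evalOn_apply] at h7
  rw [zero_smul, add_zero] at h4
  rw [← h4, h5]
  exact h7

/-- A central form has smaller degree than required along a direction that does not span an
intersection of hyperplanes: this holds for each product of linear forms in the central space. -/
lemma dirDeriv_pow_eq_zero_of_not_line [FiniteDimensional ℂ V] {i : ℕ} {G : MvPolynomial ι ℂ}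
    (hG : G ∈ inverseForms b (rhoOn l Finset.univ) i) {h : V} (hh : h ≠ 0)
    (hline : flatOf l (zeroSet l h) ≠ Submodule.span ℂ {h}) :
    (dirDeriv b h ^ (rhoOn l Finset.univ h - 1)) G = 0 := by
  classical
  let μ : (⊤ : Submodule ℂ V) → ℕ := fun k =>
    if (k : V) = h then rhoOn l Finset.univ (k : V) - 1 else rhoOn l Finset.univ (k : V)
  have h1 : evalOn b ⊤ G ∈ boundedForms (⊤ : Submodule ℂ V) (fun h => rhoOn l Finset.univ h) i := by
    rw [← map_evalOn_inverseForms (b := b)]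
    exact ⟨G, hG, rfl⟩
  rw [(centralForms_eq_productSpan l Finset.univ ⊤ i).1] at h1
  have h2 : productSpan l (fun D => D = ⊥) ⊤ Finset.univ i ≤
      boundedForms (⊤ : Submodule ℂ V) μ i := by
    refine productSpan_le_boundedForms (fun T hT hπ k hk => ?_) i
    rw [top_inf_eq] at hπ
    have h3 := rhoOn_add_rhoOn_sdiff (l := l) hT (k : V)
    have h4 : ∀ y : V, y ≠ 0 → rhoOn l (Finset.univ \ T) y ≠ 0 := fun y hy h0 => hy <| by
      have : y ∈ flatOf l (Finset.univ \ T) := rhoOn_eq_zero_iff.mp h0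
      rw [hπ] at this
      exact (Submodule.mem_bot ℂ).mp this
    have h5 := h4 k fun h0 => hk (Subtype.ext h0)
    simp only [μ]
    split_ifs with hkh
    · suffices rhoOn l (Finset.univ \ T) (k : V) ≠ 1 by omega
      rw [hkh]
      intro h6
      obtain ⟨j, hj⟩ := Finset.card_eq_one.mp h6
      have hjmem : j ∈ (Finset.univ \ T) ∧ l j h ≠ 0 :=
        Finset.mem_filter.mp (hj ▸ Finset.mem_singleton_self j)
      refine hline (le_antisymm (fun x hx => ?_) ?_)
      · -- subtracting a multiple of `h` from `x` yields a vector on all hyperplanes outside `T`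
        have h7 : x - (l j x / l j h) • h = 0 := by
          by_contra hne
          refine h4 _ hne (rhoOn_eq_zero_iff.mpr (mem_flatOf.mpr fun m hm => ?_))
          rw [map_sub, map_smul, smul_eq_mul]
          by_cases hmh : l m h = 0
          · rw [hmh, mem_flatOf.mp hx m (mem_zeroSet.mpr hmh), mul_zero, sub_zero]
          · have : m ∈ ({j} : Finset (Fin n)) := hj ▸ Finset.mem_filter.mpr ⟨hm, hmh⟩
            rw [Finset.mem_singleton.mp this, div_mul_cancel₀ _ hjmem.2, sub_self]
        exact Submodule.mem_span_singleton.mpr ⟨_, (sub_eq_zero.mp h7).symm⟩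
      · rw [Submodule.span_singleton_le_iff_mem]
        exact mem_flatOf_zeroSet h
    · omega
  have h3 := dirDeriv_pow_eq_zero_of_mem_boundedForms (h2 h1) hh
  simpa [μ] using h3

end Lines

/-! ### Lower bounds for the semi-internal spaces -/

section SemiInternal

variable {V : Type*} [AddCommGroup V] [Module ℂ V] [FiniteDimensional ℂ V] {n : ℕ}
  (l : Fin n → Dual ℂ V) {ι : Type*} [Fintype ι] (b : Basis ι ℂ V)

lemma finiteDimensional_inverseForms_semiBound (I : Finset (Fin n)) (i : ℕ) :
    FiniteDimensional ℂ (inverseForms b (semiBound l Finset.univ I) i) := by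
  have h1 := (finrank_semiForms_le l Finset.univ I (Finset.subset_univ I) ⊤ i).1
  rw [← map_evalOn_inverseForms (b := b)] at h1
  exact (Submodule.equivMapOfInjective _ (evalOn_top_injective (b := b)) _).symm.finiteDimensional

/-- Imposing the internal bound in the directions not on the hyperplane with index `e` costs at
most the top derivatives along the lines of the arrangement that leave this hyperplane. -/
lemma finrank_inverseForms_semiBound_le (I : Finset (Fin n)) (e : Fin n) (i : ℕ) :
    finrank ℂ (inverseForms b (semiBound l Finset.univ I) i) ≤
      finrank ℂ (inverseForms b (semiBound l Finset.univ (insert e I)) i) +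
        ∑ F ∈ lineFlats l I e, finrank ℂ (boundedForms (LinearMap.ker (l e))
          (fun h => semiBound l F I h) ((i : ℤ) - (n - F.card - 1 : ℕ))) := by
  classical
  have hfin := finiteDimensional_inverseForms_semiBound l b I i
  have hfin' := finiteDimensional_inverseForms_semiBound l b (insert e I) i
  have hch : ∀ F : lineFlats l I e, ∃ h, l e h ≠ 0 ∧ flatOf l F = Submodule.span ℂ {h} ∧
      (F : Finset (Fin n)) = zeroSet l h := fun F => (mem_lineFlats.mp F.2).2
  choose u hue husp huz using hch
  have huI : ∀ F, u F ∈ flatOf l I := fun F => subset_zeroSet.mp (by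
    rw [← huz]
    exact (mem_lineFlats.mp F.2).1)
  have hρ : ∀ F : lineFlats l I e, n - (F : Finset (Fin n)).card - 1 =
      rhoOn l Finset.univ (u F) - 1 := fun F => by
    have := rhoOn_univ_add_card_zeroSet (l := l) (u F)
    rw [← huz] at this
    omega
  have hfinF : ∀ F : lineFlats l I e, FiniteDimensional ℂ (boundedForms (LinearMap.ker (l e))
      (fun h => semiBound l F I h) ((i : ℤ) - (n - (F : Finset (Fin n)).card - 1 : ℕ))) := fun F =>
    (finrank_semiForms_le l F I (mem_lineFlats.mp F.2).1 _ _).1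
  let r : (F : lineFlats l I e) → MvPolynomial ι ℂ →ₗ[ℂ] (LinearMap.ker (l e) → ℂ) := fun F =>
    evalOn b (LinearMap.ker (l e)) ∘ₗ (dirDeriv b (u F) ^ (rhoOn l Finset.univ (u F) - 1))
  have hr : ∀ F : lineFlats l I e, ∀ G : inverseForms b (semiBound l Finset.univ I) i,
      (r F ∘ₗ Submodule.subtype _) G ∈ boundedForms (LinearMap.ker (l e))
        (fun h => semiBound l F I h) ((i : ℤ) - (n - (F : Finset (Fin n)).card - 1 : ℕ)) := by
    intro F G
    rw [hρ]
    refine evalOn_mem_boundedForms (fun h hh hh0 => ?_)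
      (eval_smul_dirDeriv_pow (mem_inverseForms.mp G.2).2 _ _)
    have := dirDeriv_pow_semiBound_zeroSet G.2 (huI F) (hue F) hh0 hh
    rwa [← huz] at this
  let Φ : inverseForms b (semiBound l Finset.univ I) i →ₗ[ℂ] ((F : lineFlats l I e) →
      boundedForms (LinearMap.ker (l e))
        (fun h => semiBound l F I h) ((i : ℤ) - (n - (F : Finset (Fin n)).card - 1 : ℕ))) :=
    LinearMap.pi fun F => LinearMap.codRestrict _ (r F ∘ₗ Submodule.subtype _) (hr F)
  have h1 := Φ.finrank_range_add_finrank_ker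
  have h2 : finrank ℂ (LinearMap.range Φ) ≤ ∑ F ∈ lineFlats l I e,
      finrank ℂ (boundedForms (LinearMap.ker (l e))
          (fun h => semiBound l F I h) ((i : ℤ) - (n - F.card - 1 : ℕ))) := by
    refine (Submodule.finrank_le _).trans ?_
    rw [Module.finrank_pi_fintype, ← Finset.sum_coe_sort (lineFlats l I e)]
  have h3 : finrank ℂ (LinearMap.ker Φ) ≤
      finrank ℂ (inverseForms b (semiBound l Finset.univ (insert e I)) i) := by
    rw [← Submodule.finrank_map_subtype_eq]
    refine Submodule.finrank_mono ?_
    rintro _ ⟨G, hG, rfl⟩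
    have hGm := mem_inverseForms.mp G.2
    refine mem_inverseForms.mpr ⟨fun h hh => ?_, hGm.2⟩
    by_cases hcase : h ∈ flatOf l I ∧ l e h ≠ 0
    · obtain ⟨hhI, hhe⟩ := hcase
      have hb : semiBound l Finset.univ (insert e I) h = rhoOn l Finset.univ h - 1 := by
        rw [semiBound, if_neg]
        exact fun h0 => hhe (mem_flatOf.mp h0 e (Finset.mem_insert_self e I))
      rw [hb]
      by_cases hline : flatOf l (zeroSet l h) = Submodule.span ℂ {h}
      · -- `h` is a multiple of the chosen vector `u F` on its line
        let F : lineFlats l I e := ⟨zeroSet l h, mem_lineFlats.mpr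
          ⟨subset_zeroSet.mpr hhI, h, hhe, hline, rfl⟩⟩
        have h4 : (r F) G = 0 := congrArg Subtype.val (congrFun hG F)
        have h5 := dirDeriv_pow_eq_zero_of_evalOn G.2 (hue F) h4
        have h6 : h ∈ Submodule.span ℂ {u F} := by
          rw [← husp F]
          exact mem_flatOf_zeroSet h
        obtain ⟨c, hc⟩ := Submodule.mem_span_singleton.mp h6
        have h7 : rhoOn l Finset.univ (u F) = rhoOn l Finset.univ h := by
          have e1 := rhoOn_univ_add_card_zeroSet (l := l) (u F)
          have e2 := rhoOn_univ_add_card_zeroSet (l := l) h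
          have e3 : zeroSet l h = zeroSet l (u F) := huz F
          rw [e3] at e2
          omega
        rw [h7] at h5
        rw [← hc, dirDeriv_smul, smul_pow, LinearMap.smul_apply, hc]
        exact (congrArg _ h5).trans (smul_zero _)
      · refine dirDeriv_pow_eq_zero_of_not_line (mem_inverseForms.mpr ⟨fun k hk => ?_, hGm.2⟩) hh
          hline
        exact dirDeriv_pow_eq_zero_of_le (semiBound_le_rhoOn _ _ _) (hGm.1 k hk)
    · have hb : semiBound l Finset.univ (insert e I) h = semiBound l Finset.univ I h := by
        have : h ∈ flatOf l (insert e I) ↔ h ∈ flatOf l I := by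
          rw [flatOf_insert, Submodule.mem_inf, LinearMap.mem_ker]
          tauto
        simp only [semiBound, this]
      rw [hb]
      exact hGm.1 h hh
  omega

/-- The numerical counterpart of `finrank_inverseForms_semiBound_le`: the weights for `I` and
`insert e I` differ exactly at the sets `T` for which the hyperplanes with indices in `T` and `I`
meet in a line leaving the hyperplane with index `e`; these are grouped by the line. -/
lemma subsetWeight_semiWeight_insert (I : Finset (Fin n)) (e : Fin n) :
    subsetWeight l (semiWeight l I) ⊤ Finset.univ =
      subsetWeight l (semiWeight l (insert e I)) ⊤ Finset.univ +
        ∑ F ∈ lineFlats l I e, qVar ^ (n - F.card - 1) *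
          subsetWeight l (semiWeight l I) (LinearMap.ker (l e)) F := by
  classical
  have hswap : ∑ F ∈ lineFlats l I e, qVar ^ (n - F.card - 1) *
      subsetWeight l (semiWeight l I) (LinearMap.ker (l e)) F =
      ∑ T ∈ (Finset.univ : Finset (Fin n)).powerset, ∑ F ∈ (lineFlats l I e).filter (T ⊆ ·),
        qVar ^ (n - F.card - 1) * (semiWeight l I (LinearMap.ker (l e) ⊓ flatOf l T) *
          qVar ^ ((F.card : ℤ) - T.card) * (1 - qVar) ^ ((T.card : ℤ) +
            finrank ℂ ↥(LinearMap.ker (l e) ⊓ flatOf l T) - finrank ℂ (LinearMap.ker (l e)))) := by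
    simp only [subsetWeight, Finset.mul_sum]
    refine Finset.sum_comm' fun F T => ?_
    simp only [Finset.mem_powerset, Finset.mem_filter, Finset.subset_univ, and_true]
  rw [hswap, subsetWeight, subsetWeight, ← Finset.sum_add_distrib]
  refine Finset.sum_congr rfl fun T _ => ?_
  rw [top_inf_eq, Finset.card_univ, Fintype.card_fin, finrank_top]
  have hins : flatOf l T ⊓ flatOf l (insert e I) =
      LinearMap.ker (l e) ⊓ flatOf l T ⊓ flatOf l I := by
    rw [flatOf_insert, inf_left_comm, inf_assoc]
  have hmemF : ∀ F ∈ (lineFlats l I e).filter (T ⊆ ·), ∃ h, l e h ≠ 0 ∧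
      h ∈ flatOf l T ⊓ flatOf l I ∧ flatOf l F = Submodule.span ℂ {h} ∧ F = zeroSet l h := by
    intro F hF
    obtain ⟨hF1, hTF⟩ := Finset.mem_filter.mp hF
    obtain ⟨hIF, h, hhe, hsp, hz⟩ := mem_lineFlats.mp hF1
    exact ⟨h, hhe, ⟨subset_zeroSet.mp (hz ▸ hTF), subset_zeroSet.mp (hz ▸ hIF)⟩, hsp, hz⟩
  by_cases h1 : LinearMap.ker (l e) ⊓ flatOf l T ⊓ flatOf l I = ⊥
  · by_cases h2 : flatOf l T ⊓ flatOf l I = ⊥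
    · have hempty : (lineFlats l I e).filter (T ⊆ ·) = ∅ := by
        refine Finset.eq_empty_of_forall_notMem fun F hF => ?_
        obtain ⟨h, hhe, hmem, -⟩ := hmemF F hF
        rw [h2, Submodule.mem_bot] at hmem
        rw [hmem, map_zero] at hhe
        exact hhe rfl
      rw [hempty, Finset.sum_empty, add_zero, semiWeight, semiWeight, if_pos h2,
        if_pos (hins.trans h1)]
    · obtain ⟨h, hh, hh0⟩ := (Submodule.ne_bot_iff _).mp h2
      have hhe : l e h ≠ 0 := fun h0 => hh0 <| by
        have : h ∈ LinearMap.ker (l e) ⊓ flatOf l T ⊓ flatOf l I := ⟨⟨h0, hh.1⟩, hh.2⟩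
        rw [h1] at this
        exact (Submodule.mem_bot ℂ).mp this
      -- the hyperplanes with indices in `T` and `I` meet in the line spanned by `h`
      have hspan : ∀ k ∈ flatOf l T ⊓ flatOf l I, ∃ c : ℂ, c • h = k := by
        intro k hk
        refine ⟨l e k / l e h, ?_⟩
        have h3 : k - (l e k / l e h) • h ∈ LinearMap.ker (l e) ⊓ flatOf l T ⊓ flatOf l I := by
          refine ⟨⟨?_, ?_⟩, ?_⟩
          · simp [hhe]
          · exact sub_mem hk.1 (Submodule.smul_mem _ _ hh.1)
          · exact sub_mem hk.2 (Submodule.smul_mem _ _ hh.2)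
        rw [h1, Submodule.mem_bot] at h3
        exact (sub_eq_zero.mp h3).symm
      have hsingle : (lineFlats l I e).filter (T ⊆ ·) = {zeroSet l h} := by
        refine Finset.eq_singleton_iff_unique_mem.mpr ⟨?_, fun F hF => ?_⟩
        · refine Finset.mem_filter.mpr ⟨mem_lineFlats.mpr ⟨subset_zeroSet.mpr hh.2, h, hhe,
            le_antisymm (fun k hk => ?_) ?_, rfl⟩, subset_zeroSet.mpr hh.1⟩
          · obtain ⟨c, hc⟩ := hspan k ⟨flatOf_anti l (subset_zeroSet.mpr hh.1) hk,
              flatOf_anti l (subset_zeroSet.mpr hh.2) hk⟩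
            exact Submodule.mem_span_singleton.mpr ⟨c, hc⟩
          · rw [Submodule.span_singleton_le_iff_mem]
            exact mem_flatOf_zeroSet h
        · obtain ⟨k, hke, hk, -, hz⟩ := hmemF F hF
          obtain ⟨c, hc⟩ := hspan k hk
          have hc0 : c ≠ 0 := by
            rintro rfl
            rw [← hc, zero_smul, map_zero] at hke
            exact hke rfl
          rw [hz, ← hc, zeroSet_smul hc0]
      have hTe : ¬ flatOf l T ≤ LinearMap.ker (l e) := fun hle => hhe (hle hh.1)
      have hVe : ¬ (⊤ : Submodule ℂ V) ≤ LinearMap.ker (l e) := fun hle => hhe (hle trivial)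
      have d1 := finrank_inf_ker_add_one _ hTe
      have d2 := finrank_inf_ker_add_one _ hVe
      rw [top_inf_eq, finrank_top] at d2
      rw [inf_comm (flatOf l T)] at d1
      have hcard : (zeroSet l h).card + 1 ≤ n := by
        have e1 := rhoOn_univ_add_card_zeroSet (l := l) h
        have e2 : rhoOn l Finset.univ h ≠ 0 := fun h0 =>
          hhe (mem_flatOf.mp (rhoOn_eq_zero_iff.mp h0) e (Finset.mem_univ e))
        omega
      rw [hsingle, Finset.sum_singleton, semiWeight, semiWeight, semiWeight, if_neg h2,
        if_pos (hins.trans h1), if_pos h1, ← d1, ← d2]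
      have e1 : (n : ℤ) - T.card = ((n - (zeroSet l h).card - 1 : ℕ) : ℤ) +
          ((zeroSet l h).card - T.card) + 1 := by omega
      have e2 (m k : ℕ) :
          (T.card : ℤ) + ((m + 1 : ℕ) : ℤ) - ((k + 1 : ℕ) : ℤ) = T.card + m - k := by
        push_cast
        ring
      rw [e1, e2, zpow_add_one₀ qVar_ne_zero, zpow_add₀ qVar_ne_zero, zpow_natCast, pow_succ]
      have := qVar_ne_zero
      field_simp
      ring
  · -- all weights vanish
    have h2 : ¬ flatOf l T ⊓ flatOf l I = ⊥ := fun h2 => h1 <| by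
      rw [inf_assoc, h2, inf_bot_eq]
    rw [semiWeight, semiWeight, if_neg h2, if_neg (hins ▸ h1), zero_mul, zero_mul, zero_add]
    refine (Finset.sum_eq_zero fun F _ => ?_).symm
    rw [semiWeight, if_neg h1, zero_mul, zero_mul, mul_zero]

/-- The lower bound for semi-internal spaces, starting from the central space and adding the
distinguished forms one at a time. -/
lemma coeff_le_finrank_inverseForms_semiBound (I : Finset (Fin n)) (i : ℕ) :
    (subsetWeight l (semiWeight l I) ⊤ Finset.univ).coeff i ≤
      (finrank ℂ (inverseForms b (semiBound l Finset.univ I) i) : ℚ) := by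
  induction I using Finset.induction_on with
  | empty =>
    have h1 := (centralForms_eq_productSpan l Finset.univ ⊤ i).2
    have h2 : semiBound l Finset.univ ∅ = rhoOn l Finset.univ := funext (semiBound_empty _)
    rw [h2, finrank_inverseForms]
    exact h1.ge
  | insert e I _ ih =>
    rw [subsetWeight_semiWeight_insert l I e, HahnSeries.coeff_add, HahnSeries.coeff_sum] at ih
    have h1 : (finrank ℂ (inverseForms b (semiBound l Finset.univ I) i) : ℚ) ≤
        finrank ℂ (inverseForms b (semiBound l Finset.univ (insert e I)) i) +
        ∑ F ∈ lineFlats l I e, (finrank ℂ (boundedForms (LinearMap.ker (l e))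
          (fun h => semiBound l F I h) ((i : ℤ) - (n - F.card - 1 : ℕ))) : ℚ) := by
      exact_mod_cast finrank_inverseForms_semiBound_le l b I e i
    have h2 : ∑ F ∈ lineFlats l I e, (finrank ℂ (boundedForms (LinearMap.ker (l e))
          (fun h => semiBound l F I h) ((i : ℤ) - (n - F.card - 1 : ℕ))) : ℚ) ≤
        ∑ F ∈ lineFlats l I e, (qVar ^ (n - F.card - 1) *
          subsetWeight l (semiWeight l I) (LinearMap.ker (l e)) F).coeff (i : ℤ) := by
      refine Finset.sum_le_sum fun F hF => ?_
      rw [coeff_qVar_pow_mul]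
      exact (finrank_semiForms_le l F I (mem_lineFlats.mp hF).1 _ _).2
    linarith

end SemiInternal

/-! ### The Tutte polynomial -/

section Tutte

variable {V : Type*} [AddCommGroup V] [Module ℂ V] {n : ℕ}
  (l : Fin n → Dual ℂ V)

lemma arrangementMatroid_indep_iff {I : Set (Fin n)} :
    (arrangementMatroid l).Indep I ↔ LinearIndepOn ℂ l I := by
  simp [arrangementMatroid]

lemma matroidRk_le_card (T : Finset (Fin n)) :
    matroidRk (arrangementMatroid l) (T : Set (Fin n)) ≤ T.card := by
  have h := (arrangementMatroid l).eRk_le_encard (T : Set (Fin n))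
  rw [Set.encard_coe_eq_coe_finsetCard] at h
  exact ENat.toNat_le_of_le_natCast h

variable [FiniteDimensional ℂ V]

/-- The rank of a set of forms is the codimension of the intersection of their kernels. -/
lemma matroidRk_add_finrank_flatOf (T : Finset (Fin n)) :
    matroidRk (arrangementMatroid l) (T : Set (Fin n)) + finrank ℂ (flatOf l T) =
      finrank ℂ V := by
  classical
  obtain ⟨I, hI⟩ := (arrangementMatroid l).exists_isBasis (T : Set (Fin n)) (by
    simp [arrangementMatroid])
  have hind : LinearIndepOn ℂ l I := (arrangementMatroid_indep_iff l).mp hI.indep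
  have hspan : Submodule.span ℂ (l '' I) = Submodule.span ℂ (l '' (T : Set (Fin n))) := by
    refine le_antisymm (Submodule.span_mono (Set.image_mono hI.subset)) ?_
    rw [Submodule.span_le]
    rintro _ ⟨e, he, rfl⟩
    by_cases heI : e ∈ I
    · exact Submodule.subset_span ⟨e, heI, rfl⟩
    · by_contra hns
      have h1 : (arrangementMatroid l).Indep (insert e I) :=
        (arrangementMatroid_indep_iff l).mpr (hind.insert hns)
      exact heI (hI.mem_of_insert_indep he h1)
  have hrk : matroidRk (arrangementMatroid l) (T : Set (Fin n)) =
      finrank ℂ (Submodule.span ℂ (l '' I)) := by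
    rw [matroidRk, ← hI.encard_eq_eRk, Set.image_eq_range]
    have := finrank_span_eq_card (R := ℂ) (b := fun i : I => l i) hind
    rw [this, ← Set.toFinset_card, ← Set.ncard_eq_toFinset_card']
    rfl
  have hco : flatOf l T = (Submodule.span ℂ (l '' (T : Set (Fin n)))).dualCoannihilator := by
    ext x
    rw [mem_flatOf, Submodule.mem_dualCoannihilator]
    constructor
    · intro h φ hφ
      refine Submodule.span_induction (p := fun φ _ => φ x = 0) ?_ (by simp)
        (fun a b _ _ ha hb => by simp [ha, hb]) (fun c a _ ha => by simp [ha]) hφ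
      rintro _ ⟨i, hi, rfl⟩
      exact h i hi
    · intro h i hi
      exact h _ (Submodule.subset_span ⟨i, hi, rfl⟩)
  rw [hrk, hspan, hco, Subspace.finrank_add_finrank_dualCoannihilator_eq]

/-- The evaluations of the Tutte polynomial at `y = 1 / q` are weighted sums over subsets, with a
weight that only depends on the dimensions of intersections of hyperplanes. -/
lemma qVar_zpow_mul_tutteEval (x : LaurentSeries ℚ) :
    qVar ^ ((n : ℤ) - arrangementRank l) * tutteEval l x qVar⁻¹ =
      subsetWeight l (fun D => ((x - 1) / qVar) ^
        (finrank ℂ D - finrank ℂ (flatOf l Finset.univ))) ⊤ Finset.univ := by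
  have hq := qVar_ne_zero
  have hrank : arrangementRank l + finrank ℂ (flatOf l Finset.univ) = finrank ℂ V := by
    have := matroidRk_add_finrank_flatOf l Finset.univ
    rwa [Finset.coe_univ] at this
  rw [tutteEval, tuttePolynomial, map_sum, subsetWeight, Finset.powerset_univ, Finset.mul_sum]
  refine Finset.sum_congr rfl fun T _ => ?_
  have h1 := matroidRk_add_finrank_flatOf l T
  have h2 := matroidRk_le_card l T
  have h3 := Submodule.finrank_mono (flatOf_anti l (Finset.subset_univ T))
  have ha : matroidRk (arrangementMatroid l) Set.univ -
      matroidRk (arrangementMatroid l) (T : Set (Fin n)) =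
      finrank ℂ (flatOf l T) - finrank ℂ (flatOf l Finset.univ) := by
    have : matroidRk (arrangementMatroid l) Set.univ = arrangementRank l := rfl
    omega
  rw [top_inf_eq, finrank_top, Finset.card_univ, Fintype.card_fin]
  simp only [map_mul, map_pow, map_sub, MvPolynomial.aeval_X, map_one, Matrix.cons_val_zero,
    Matrix.cons_val_one]
  rw [ha]
  set a := finrank ℂ (flatOf l T) - finrank ℂ (flatOf l Finset.univ) with hadef
  set c := T.card - matroidRk (arrangementMatroid l) (T : Set (Fin n)) with hcdef
  have e1 : (T.card : ℤ) + finrank ℂ (flatOf l T) - finrank ℂ V = c := by omega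
  have e2 : (n : ℤ) - arrangementRank l = ((n : ℤ) - T.card) + c - a := by omega
  have e3 : qVar⁻¹ - 1 = (1 - qVar) / qVar := by field_simp
  rw [e1, e2, e3, zpow_sub₀ hq, zpow_add₀ hq, zpow_natCast, zpow_natCast, zpow_natCast, div_pow,
    div_pow]
  field_simp

lemma coeff_semiWeight_of_neg (I : Finset (Fin n)) {i : ℤ} (hi : i < 0) :
    (subsetWeight l (semiWeight l I) ⊤ Finset.univ).coeff i ≤ 0 := by
  induction I using Finset.induction_on with
  | empty =>
    obtain ⟨h1, h2⟩ := centralForms_eq_productSpan l Finset.univ ⊤ i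
    rw [productSpan_of_neg _ _ _ hi] at h1
    rw [← h2, h1]
    simp
  | insert e I _ ih =>
    rw [subsetWeight_semiWeight_insert l I e, HahnSeries.coeff_add, HahnSeries.coeff_sum] at ih
    have h2 : 0 ≤ ∑ F ∈ lineFlats l I e, (qVar ^ (n - F.card - 1) *
          subsetWeight l (semiWeight l I) (LinearMap.ker (l e)) F).coeff i := by
      refine Finset.sum_nonneg fun F hF => ?_
      rw [coeff_qVar_pow_mul]
      exact le_trans (by positivity) (finrank_semiForms_le l F I (mem_lineFlats.mp hF).1 _ _).2
    linarith

lemma finrank_inverseForms_semiBound {ι : Type*} [Fintype ι] (b : Basis ι ℂ V)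
    (I : Finset (Fin n)) (i : ℕ) :
    (finrank ℂ (inverseForms b (semiBound l Finset.univ I) i) : ℚ) =
      (subsetWeight l (semiWeight l I) ⊤ Finset.univ).coeff (i : ℤ) := by
  refine le_antisymm ?_ (coeff_le_finrank_inverseForms_semiBound l b I i)
  rw [finrank_inverseForms]
  exact (finrank_semiForms_le l Finset.univ I (Finset.subset_univ I) ⊤ i).2

end Tutte

/-! ### Hilbert series -/

lemma coe_hilbSeries_eq {ι : Type*} {C : Submodule ℂ (MvPolynomial ι ℂ)} {w : LaurentSeries ℚ}
    (h : ∀ i : ℕ, (finrank ℂ ↥(C ⊓ MvPolynomial.homogeneousSubmodule ι ℂ i) : ℚ) = w.coeff i)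
    (hneg : ∀ i : ℤ, i < 0 → w.coeff i = 0) : (hilbSeries C : LaurentSeries ℚ) = w := by
  ext i
  rw [PowerSeries.coeff_coe]
  split_ifs with hi
  · exact (hneg i hi).symm
  · rw [hilbSeries, PowerSeries.coeff_mk, h, Int.natAbs_of_nonneg (not_lt.mp hi)]

end

theorem corollary4p13 {V : Type*} [AddCommGroup V] [Module ℂ V]
    {ι : Type*} [Fintype ι] (b : Module.Basis ι ℂ V)
    (n : ℕ) (l : Fin n → Module.Dual ℂ V) (r : ℕ) (hr : arrangementRank l = r) :
    ((hilbSeries (powerInverseSystem b l 0) : LaurentSeries ℚ)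
        = qVar ^ ((n : ℤ) - (r : ℤ)) * tutteEval l (1 + qVar) qVar⁻¹) ∧
    (IsEssentialArr l →
      ((hilbSeries (powerInverseSystem b l (-1)) : LaurentSeries ℚ)
          = qVar ^ ((n : ℤ) - (r : ℤ)) * tutteEval l 1 qVar⁻¹) ∧
      ((hilbSeries (powerInverseSystem b l (-2)) : LaurentSeries ℚ)
          = qVar ^ ((n : ℤ) - (r : ℤ)) * tutteEval l 0 qVar⁻¹)) := by
  classical
  subst hr
  have hfin : FiniteDimensional ℂ V := Module.Finite.of_basis b
  have hq := qVar_ne_zero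
  have hsys : ∀ (k : ℤ) (μ : V → ℕ), (∀ h, ((rhoOn l Finset.univ h : ℤ) + k + 1).toNat = μ h) →
      ∀ i : ℕ, powerInverseSystem b l k ⊓ MvPolynomial.homogeneousSubmodule ι ℂ i =
        inverseForms b μ i := by
    intro k μ hμ i
    obtain rfl : (fun h => ((rhoOn l Finset.univ h : ℤ) + k + 1).toNat) = μ := funext hμ
    rfl
  refine ⟨?_, fun hess => ?_⟩
  · rw [qVar_zpow_mul_tutteEval, subsetWeight_congr l (ψ := fun _ => 1) fun T _ => by
      rw [add_sub_cancel_left, div_self hq, one_pow]]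
    refine coe_hilbSeries_eq (fun i => ?_) fun i hi => ?_
    · rw [hsys 0 (fun h => rhoOn l Finset.univ h + 1) (fun h => by omega), finrank_inverseForms]
      exact (externalForms_eq_productSpan l Finset.univ ⊤ i).2
    · obtain ⟨h1, h2⟩ := externalForms_eq_productSpan l Finset.univ ⊤ i
      rw [productSpan_of_neg _ _ _ hi] at h1
      rw [← h2, h1]
      simp
  · have hbot : flatOf l Finset.univ = ⊥ := by
      rw [← (show ⨅ i, LinearMap.ker (l i) = ⊥ from hess)]
      simp [flatOf]
    have hnonneg : ∀ I i, 0 ≤ (subsetWeight l (semiWeight l I) ⊤ Finset.univ).coeff i := fun I i =>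
      le_trans (by positivity) (finrank_semiForms_le l Finset.univ I (Finset.subset_univ I) ⊤ i).2
    constructor
    · rw [qVar_zpow_mul_tutteEval, subsetWeight_congr l (ψ := semiWeight l ∅) fun T _ => by
        rw [semiWeight, flatOf_empty, inf_top_eq, hbot, finrank_bot, Nat.sub_zero, sub_self,
          zero_div]
        split_ifs with hD
        · rw [hD, finrank_bot, pow_zero, pow_zero]
        · exact zero_pow (by rwa [Ne, Submodule.finrank_eq_zero])]
      refine coe_hilbSeries_eq (fun i => ?_) fun i hi =>
        le_antisymm (coeff_semiWeight_of_neg l ∅ hi) (hnonneg ∅ i)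
      rw [hsys (-1) (semiBound l Finset.univ ∅) (fun h => by rw [semiBound_empty]; omega)]
      exact finrank_inverseForms_semiBound l b ∅ i
    · have h0 : (0 - 1 : LaurentSeries ℚ) / qVar = -qVar⁻¹ := by
        field_simp
        ring
      rw [qVar_zpow_mul_tutteEval,
        subsetWeight_congr l (ψ := semiWeight l Finset.univ) fun T _ => by
        rw [semiWeight, hbot, inf_bot_eq, if_pos rfl, finrank_bot, Nat.sub_zero, h0]]
      refine coe_hilbSeries_eq (fun i => ?_) fun i hi =>
        le_antisymm (coeff_semiWeight_of_neg l _ hi) (hnonneg _ i)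
      rw [hsys (-2) (semiBound l Finset.univ Finset.univ) (fun h => by
        rw [semiBound]
        split_ifs with hh
        · -- only `h = 0` occurs here, where the exponent `-1` is truncated to zero
          rw [rhoOn_eq_zero_iff.mpr hh]
          rfl
        · omega)]
      exact finrank_inverseForms_semiBound l b Finset.univ i
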